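/- Let $m,n\ge 0$ be integers. For matrices $X,Y$ of equal size put $\Delta(X,Y)=\left(\begin{smallmatrix}X&Y\\ \overline{Y}&\overline{X}\end{smallmatrix}\right)$; let $J=\mathrm{diag}(1,-1)$ (blocks of equal size) and $Z^\flat=JZ^\dagger J$. A quantum linear system (QLS) $(S,C,\Omega)$ with $n$ modes and $m$ channels is given by $S=\Delta(S_-,S_+)\in\mathbb{C}^{2m\times 2m}$ with $S^\flat S=SS^\flat=1$, $C=\Delta(C_-,C_+)\in\mathbb{C}^{2m\times 2n}$ and $\Omega=\Delta(\Omega_-,\Omega_+)\in\mathbb{C}^{2n\times 2n}$ with $\Omega_-^\dagger=\Omega_-$, $\Omega_+^T=\Omega_+$. Its system matrix is $A=-\tfrac12C^\flat C-iJ\Omega$; it is Hurwitz stable if all eigenvalues of $A$ have negative real part. Its transfer function is $\Xi(s)=\big(1-C(s-A)^{-1}C^\flat\big)S$, and for vacuum input, with covariance $V=\mathrm{diag}(1,0)\in\mathbb{C}^{2m\times 2m}$ (blocks of size $m$), its power spectrum is the rational function $\Psi(s)=\Xi(s)\,V\,\Xi(-\bar s)^\dagger$. The QLS is globally minimal (for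 vacuum input) if no Hurwitz stable QLS with $m$ channels and fewer than $n$ modes has the same power spectrum. A classical linear system $(A_c,B_c,C_c,D_c)$ is the system $\dot x=A_cx+B_cu$, $y=C_cx+D_cu$ with complex matrices. It is minimal if no classical system with smaller state dimension has the same transfer function $C_c(s-A_c)^{-1}B_c+D_c$; controllable if for all states $x_0,x_1$ and all times $t_0<t_1$ there is a piecewise continuous input $u$ steering $x(t_0)=x_0$ to $x(t_1)=x_1$; and observable if for all $t_0<t_1$ the input and output on $[t_0,t_1]$ determine $x(t_0)$. **Theorem.** Let $(C,\Omega)$ be a Hurwitz stable QLS with $n$ modes, $m$ channels and $S=1$, with vacuum input, and consider the classical system with state dimension $4n$ $$\left(\tilde A,\tilde B,\tilde C,\tilde D\right)=\left(\begin{pmatrix}-A^\flat&0\\ C^\flat VC&A\end{pmatrix},\ \begin{pmatrix}-C^\flat\\ -C^\flat V\end{pmatrix},\ \begin{pmatrix}-VC& C\end{pmatrix},\ V\right).$$ Its transfer function is $\Psi(s)J$. Moreover, the following are equivalent: (i) $(C,\Omega)$ is globally minimal; (ii) $(\tilde A,\tilde B,\tilde C,\tilde D)$ is minimal; (iii) $(\tilde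 A,\tilde B,\tilde C,\tilde D)$ is controllable and observable. -/

import Mathlib

open scoped Matrix
open Topology

noncomputable section

/-! ### Classical linear systems -/

/-- A (complex, finite-dimensional) classical linear system
`dx = A x dt + B u dt`, `dy = C x dt + D u dt`, with state coordinates indexed by `ι`, inputs
indexed by `μ` and outputs indexed by `ν`. -/
structure ClassicalSystem (ι μ ν : Type) where
  A : Matrix ι ι ℂ
  B : Matrix ι μ ℂ
  C : Matrix ν ι ℂ
  D : Matrix ν μ ℂ

/-- `u` is piecewise continuous on `[a, b]`: it is continuous away from finitely many points, and
all its one-sided limits exist. -/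
def PiecewiseContinuousOn {μ : Type} (u : ℝ → μ → ℂ) (a b : ℝ) : Prop :=
  (∃ F : Set ℝ, F.Finite ∧ ContinuousOn u (Set.Icc a b \ F)) ∧
  (∀ t ∈ Set.Ico a b, ∃ l, Filter.Tendsto u (𝓝[>] t) (𝓝 l)) ∧
  (∀ t ∈ Set.Ioc a b, ∃ l, Filter.Tendsto u (𝓝[<] t) (𝓝 l))

namespace ClassicalSystem

variable {ι μ ν : Type} [Fintype ι] [Fintype μ] [Fintype ν]

/-- `x` is a state trajectory on `[t₀, t₁]` driven by the input `u`: it is continuous and satisfies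
`x' = A x + B u` at all but finitely many times. -/
def IsTrajectory (Γ : ClassicalSystem ι μ ν) (t₀ t₁ : ℝ) (u : ℝ → μ → ℂ) (x : ℝ → ι → ℂ) : Prop :=
  ContinuousOn x (Set.Icc t₀ t₁) ∧
  ∃ F : Set ℝ, F.Finite ∧
    ∀ t ∈ Set.Ioo t₀ t₁ \ F, HasDerivAt x (Γ.A *ᵥ x t + Γ.B *ᵥ u t) t

/-- The output signal `C x + D u`. -/
def output (Γ : ClassicalSystem ι μ ν) (u : ℝ → μ → ℂ) (x : ℝ → ι → ℂ) (t : ℝ) : ν → ℂ :=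
  Γ.C *ᵥ x t + Γ.D *ᵥ u t

/-- Controllability: every state can be steered to every other state, in any time interval, by a
piecewise continuous input. -/
def IsControllable (Γ : ClassicalSystem ι μ ν) : Prop :=
  ∀ (x₀ x₁ : ι → ℂ) (t₀ t₁ : ℝ), t₀ < t₁ →
    ∃ (u : ℝ → μ → ℂ) (x : ℝ → ι → ℂ),
      PiecewiseContinuousOn u t₀ t₁ ∧ Γ.IsTrajectory t₀ t₁ u x ∧ x t₀ = x₀ ∧ x t₁ = x₁

/-- Observability: on any time interval, the input and the output determine the initial state. -/
def IsObservable (Γ : ClassicalSystem ι μ ν) : Prop :=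
  ∀ (t₀ t₁ : ℝ), t₀ < t₁ →
    ∀ (u : ℝ → μ → ℂ) (x x' : ℝ → ι → ℂ), PiecewiseContinuousOn u t₀ t₁ →
      Γ.IsTrajectory t₀ t₁ u x → Γ.IsTrajectory t₀ t₁ u x' →
      (∀ t ∈ Set.Icc t₀ t₁, Γ.output u x t = Γ.output u x' t) →
      x t₀ = x' t₀

/-- The transfer function `C (s - A)⁻¹ B + D`, meaningful for `s` outside the spectrum of `A`. -/
def transferFunction [DecidableEq ι] (Γ : ClassicalSystem ι μ ν) (s : ℂ) : Matrix ν μ ℂ :=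
  Γ.C * (s • (1 : Matrix ι ι ℂ) - Γ.A)⁻¹ * Γ.B + Γ.D

/-- Equality of transfer functions as rational functions: they agree wherever both are defined. -/
def SameTransferFunction [DecidableEq ι] {κ : Type} [Fintype κ] [DecidableEq κ]
    (Γ : ClassicalSystem ι μ ν) (Γ' : ClassicalSystem κ μ ν) : Prop :=
  ∀ s : ℂ, s ∈ resolventSet ℂ Γ.A → s ∈ resolventSet ℂ Γ'.A →
    Γ.transferFunction s = Γ'.transferFunction s

/-- Minimality: no system with a smaller state space has the same transfer function. -/
def IsMinimal [DecidableEq ι] (Γ : ClassicalSystem ι μ ν) : Prop :=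
  ∀ k < Fintype.card ι, ∀ Γ' : ClassicalSystem (Fin k) μ ν, ¬ Γ.SameTransferFunction Γ'

end ClassicalSystem

/-! ### Doubled-up matrices -/

/-- The doubled-up matrix `Δ(X, Y)`, with blocks `X, Y` above `conj Y, conj X`. -/
def doubledUp {α β : Type} (X Y : Matrix α β ℂ) : Matrix (α ⊕ α) (β ⊕ β) ℂ :=
  Matrix.fromBlocks X Y (Y.map star) (X.map star)

/-- `J = diag(1, -1)`. -/
def sympJ (α : Type) [DecidableEq α] : Matrix (α ⊕ α) (α ⊕ α) ℂ :=
  Matrix.fromBlocks 1 0 0 (-1)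

/-- The symplectic adjoint `Z♭ = J Z† J`. -/
def flat {α β : Type} [Fintype α] [DecidableEq α] [Fintype β] [DecidableEq β]
    (Z : Matrix (α ⊕ α) (β ⊕ β) ℂ) : Matrix (β ⊕ β) (α ⊕ α) ℂ :=
  sympJ β * Zᴴ * sympJ α

/-- The covariance matrix `diag(1, 0)` of the vacuum. -/
def vacuumCov (α : Type) [DecidableEq α] : Matrix (α ⊕ α) (α ⊕ α) ℂ :=
  Matrix.fromBlocks 1 0 0 0

/-! ### Quantum linear systems -/

/-- The parameters `(S, C, Ω)` of a quantum linear system with `n` internal modes and `m` field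
channels: `S = Δ(S₋, S₊)` symplectic (field scattering and squeezing), `C = Δ(C₋, C₊)` (coupling)
and `Ω = Δ(Ω₋, Ω₊)` with `Ω₋` Hermitian and `Ω₊` symmetric (Hamiltonian). -/
structure QLS (n m : ℕ) where
  Sminus : Matrix (Fin m) (Fin m) ℂ
  Splus : Matrix (Fin m) (Fin m) ℂ
  Cminus : Matrix (Fin m) (Fin n) ℂ
  Cplus : Matrix (Fin m) (Fin n) ℂ
  Ωminus : Matrix (Fin n) (Fin n) ℂ
  Ωplus : Matrix (Fin n) (Fin n) ℂ
  flat_mul_S : flat (doubledUp Sminus Splus) * doubledUp Sminus Splus = 1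
  S_mul_flat : doubledUp Sminus Splus * flat (doubledUp Sminus Splus) = 1
  Ωminus_hermitian : Ωminusᴴ = Ωminus
  Ωplus_symmetric : Ωplusᵀ = Ωplus

namespace QLS

variable {n m : ℕ}

/-- The doubled-up field transformation `S`. -/
def S (G : QLS n m) : Matrix (Fin m ⊕ Fin m) (Fin m ⊕ Fin m) ℂ := doubledUp G.Sminus G.Splus

/-- The doubled-up coupling matrix `C`. -/
def C (G : QLS n m) : Matrix (Fin m ⊕ Fin m) (Fin n ⊕ Fin n) ℂ := doubledUp G.Cminus G.Cplus

/-- The doubled-up Hamiltonian matrix `Ω`. -/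
def Ω (G : QLS n m) : Matrix (Fin n ⊕ Fin n) (Fin n ⊕ Fin n) ℂ := doubledUp G.Ωminus G.Ωplus

/-- The system matrix `A = -½ C♭ C - i J Ω`. -/
def A (G : QLS n m) : Matrix (Fin n ⊕ Fin n) (Fin n ⊕ Fin n) ℂ :=
  -((1 / 2 : ℂ) • (flat G.C * G.C)) - Complex.I • (sympJ (Fin n) * G.Ω)

/-- Hurwitz stability: all eigenvalues of `A` lie in the open left half plane. -/
def IsHurwitz (G : QLS n m) : Prop := ∀ z ∈ spectrum ℂ G.A, z.re < 0

/-- The transfer function `Ξ(s) = (1 - C (s - A)⁻¹ C♭) S`, meaningful for `s` outside the spectrum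
of `A`. -/
def transferFunction (G : QLS n m) (s : ℂ) : Matrix (Fin m ⊕ Fin m) (Fin m ⊕ Fin m) ℂ :=
  (1 - G.C * (s • (1 : Matrix (Fin n ⊕ Fin n) (Fin n ⊕ Fin n) ℂ) - G.A)⁻¹ * flat G.C) * G.S

/-- The power spectrum `Ψ_V(s) = Ξ(s) V Ξ(-s*)†` for input covariance `V`, meaningful if neither
`s` nor `-s*` is in the spectrum of `A`. -/
def powerSpectrum (V : Matrix (Fin m ⊕ Fin m) (Fin m ⊕ Fin m) ℂ) (G : QLS n m) (s : ℂ) :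
    Matrix (Fin m ⊕ Fin m) (Fin m ⊕ Fin m) ℂ :=
  G.transferFunction s * V * (G.transferFunction (-star s))ᴴ

/-- Equality of power spectra as rational functions: they agree wherever both are defined. -/
def SamePowerSpectrum {n' : ℕ} (V : Matrix (Fin m ⊕ Fin m) (Fin m ⊕ Fin m) ℂ)
    (G : QLS n m) (G' : QLS n' m) : Prop :=
  ∀ s : ℂ, s ∈ resolventSet ℂ G.A → -star s ∈ resolventSet ℂ G.A →
    s ∈ resolventSet ℂ G'.A → -star s ∈ resolventSet ℂ G'.A →
    G.powerSpectrum V s = G'.powerSpectrum V s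

/-- Global minimality for input covariance `V`: no (Hurwitz stable) quantum linear system with
fewer modes has the same power spectrum. -/
def IsGloballyMinimal (V : Matrix (Fin m ⊕ Fin m) (Fin m ⊕ Fin m) ℂ) (G : QLS n m) : Prop :=
  ∀ n' < n, ∀ G' : QLS n' m, G'.IsHurwitz → ¬ G.SamePowerSpectrum V G'

/-- The classical cascade, for `S = 1` and vacuum input: the output of
`(-A♭, -C♭, -V C, V)` is fed into `(A, -C♭ V, C, V)`, where `V = diag(1, 0)`. Its state space has
dimension `4 n`. -/
def cascade (G : QLS n m) :
    ClassicalSystem ((Fin n ⊕ Fin n) ⊕ (Fin n ⊕ Fin n)) (Fin m ⊕ Fin m) (Fin m ⊕ Fin m) where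
  A := Matrix.fromBlocks (-flat G.A) 0 (flat G.C * vacuumCov (Fin m) * G.C) G.A
  B := Matrix.fromRows (-flat G.C) (-(flat G.C * vacuumCov (Fin m)))
  C := Matrix.fromCols (-(vacuumCov (Fin m) * G.C)) G.C
  D := vacuumCov (Fin m)

end QLS

end

open scoped Matrix
open Topology

noncomputable section

set_option linter.unusedSectionVars false

/-! ### The symplectic adjoint -/

section Flat

variable {α β γ : Type} [Fintype α] [DecidableEq α] [Fintype β] [DecidableEq β]
  [Fintype γ] [DecidableEq γ]

/-! Controllability plus observability gives minimality by Kalman's argument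
(`card_le_of_sameTransferFunction`). Minimality of the cascade gives global minimality because every
competing system with `n'` modes yields a cascade of dimension `4 n'` realising its own power
spectrum times `J` (`QLS.powerSpectrum_mul_sympJ`).

The substance is that global minimality forces controllability and observability. By the Hautus test
a failure of either is witnessed by a right or left eigenvector of the cascade matrix. The identity
`A + A♭ = -C♭ C` separates its two components, and in both cases, possibly after the conjugation
`(a, b) ↦ (conj b, conj a)`, there remains an eigenvector `f ≠ 0` of `A♭` with `V C f = 0`
(`QLS.not_isGloballyMinimal_of_two_modes`).

If `c` is its eigenvalue, then `2 Re(c) f†Jf = |C f|²`, and Hurwitz stability makes `f†Jf` strictly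
negative (`QLS.sympForm_self_re_neg`). Hence the conjugate of `f` can be normalised to `J`-norm one
and completed to a symplectic basis. In that basis the system is a series product in which the field
first meets a single mode (`quantumTransfer_splitting`). The matrices of that mode commute with `V`:
it is passive, so it sends vacuum to vacuum. Deleting it leaves a stable system with one mode fewer
and the same power spectrum. -/

theorem sympJ_mul_self : sympJ α * sympJ α = 1 := by
  simp [sympJ, Matrix.fromBlocks_multiply, Matrix.fromBlocks_one]

theorem sympJ_conjTranspose : (sympJ α)ᴴ = sympJ α := by
  simp [sympJ, Matrix.fromBlocks_conjTranspose]

theorem sympJ_mul_sympJ_mul (M : Matrix (α ⊕ α) β ℂ) : sympJ α * (sympJ α * M) = M := by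
  rw [← Matrix.mul_assoc, sympJ_mul_self, Matrix.one_mul]

theorem inv_sympJ : (sympJ α)⁻¹ = sympJ α :=
  Matrix.inv_eq_left_inv sympJ_mul_self

theorem flat_mul (X : Matrix (α ⊕ α) (β ⊕ β) ℂ) (Y : Matrix (β ⊕ β) (γ ⊕ γ) ℂ) :
    flat (X * Y) = flat Y * flat X := by
  simp only [flat, Matrix.conjTranspose_mul, Matrix.mul_assoc, sympJ_mul_sympJ_mul]

theorem flat_flat (X : Matrix (α ⊕ α) (β ⊕ β) ℂ) : flat (flat X) = X := by
  simp only [flat, Matrix.conjTranspose_mul, Matrix.mul_assoc, sympJ_mul_sympJ_mul,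
    sympJ_conjTranspose, Matrix.conjTranspose_conjTranspose, sympJ_mul_self, Matrix.mul_one]

theorem conjTranspose_eq_flat (X : Matrix (α ⊕ α) (β ⊕ β) ℂ) :
    Xᴴ = sympJ β * flat X * sympJ α := by
  simp only [flat, Matrix.mul_assoc, sympJ_mul_sympJ_mul, sympJ_mul_self, Matrix.mul_one]

theorem flat_one : flat (1 : Matrix (α ⊕ α) (α ⊕ α) ℂ) = 1 := by
  simp [flat, sympJ_mul_self]

theorem flat_sub (X Y : Matrix (α ⊕ α) (β ⊕ β) ℂ) : flat (X - Y) = flat X - flat Y := by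
  simp [flat, Matrix.mul_sub, Matrix.sub_mul]

theorem flat_neg (X : Matrix (α ⊕ α) (β ⊕ β) ℂ) : flat (-X) = -flat X := by
  simp [flat]

theorem flat_smul (c : ℂ) (X : Matrix (α ⊕ α) (β ⊕ β) ℂ) : flat (c • X) = star c • flat X := by
  simp [flat]

theorem flat_inv (X : Matrix (α ⊕ α) (α ⊕ α) ℂ) : flat X⁻¹ = (flat X)⁻¹ := by
  simp only [flat, Matrix.mul_inv_rev, inv_sympJ, Matrix.conjTranspose_nonsing_inv,
    Matrix.mul_assoc]

theorem isUnit_flat_iff {X : Matrix (α ⊕ α) (α ⊕ α) ℂ} : IsUnit (flat X) ↔ IsUnit X := by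
  have key : ∀ Y : Matrix (α ⊕ α) (α ⊕ α) ℂ, IsUnit Y → IsUnit (flat Y) := fun Y hY => by
    obtain ⟨Z, h1, h2⟩ := isUnit_iff_exists.1 hY
    exact isUnit_iff_exists.2 ⟨flat Z, by rw [← flat_mul, h2, flat_one],
      by rw [← flat_mul, h1, flat_one]⟩
  exact ⟨fun h => by simpa [flat_flat] using key _ h, key X⟩

theorem vacuumCov_mul_sympJ : vacuumCov α * sympJ α = vacuumCov α := by
  simp [sympJ, vacuumCov, Matrix.fromBlocks_multiply]

theorem sympJ_mul_vacuumCov : sympJ α * vacuumCov α = vacuumCov α := by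
  simp [sympJ, vacuumCov, Matrix.fromBlocks_multiply]

theorem vacuumCov_mul_self : vacuumCov α * vacuumCov α = vacuumCov α := by
  simp [vacuumCov, Matrix.fromBlocks_multiply]

theorem vacuumCov_conjTranspose : (vacuumCov α)ᴴ = vacuumCov α := by
  simp [vacuumCov, Matrix.fromBlocks_conjTranspose]

theorem mem_resolventSet_iff_isUnit {ι : Type} [Fintype ι] [DecidableEq ι] {A : Matrix ι ι ℂ}
    {s : ℂ} : s ∈ resolventSet ℂ A ↔ IsUnit (s • (1 : Matrix ι ι ℂ) - A) := by
  rw [spectrum.mem_resolventSet_iff, Algebra.algebraMap_eq_smul_one]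

theorem flat_smul_one_sub (s : ℂ) (A : Matrix (α ⊕ α) (α ⊕ α) ℂ) :
    flat (s • 1 - A) = star s • 1 - flat A := by
  rw [flat_sub, flat_smul, flat_one]

theorem mem_resolventSet_neg_flat_iff {A : Matrix (α ⊕ α) (α ⊕ α) ℂ} {s : ℂ} :
    s ∈ resolventSet ℂ (-flat A) ↔ -star s ∈ resolventSet ℂ A := by
  have h : s • (1 : Matrix (α ⊕ α) (α ⊕ α) ℂ) - -flat A = -flat ((-star s) • 1 - A) := by
    rw [flat_smul_one_sub]; simp; abel
  rw [mem_resolventSet_iff_isUnit, mem_resolventSet_iff_isUnit, h, IsUnit.neg_iff, isUnit_flat_iff]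

end Flat

/-! ### Cascades -/

/-- The series connection with transfer function
`(1 - C (s - A)⁻¹ C♭) K (1 + C (s + A♭)⁻¹ C♭)`. -/
def spectralCascade {α μ : Type} [Fintype α] [DecidableEq α] [Fintype μ] [DecidableEq μ]
    (A : Matrix (α ⊕ α) (α ⊕ α) ℂ) (C : Matrix (μ ⊕ μ) (α ⊕ α) ℂ)
    (K : Matrix (μ ⊕ μ) (μ ⊕ μ) ℂ) :
    ClassicalSystem ((α ⊕ α) ⊕ (α ⊕ α)) (μ ⊕ μ) (μ ⊕ μ) where
  A := Matrix.fromBlocks (-flat A) 0 (flat C * K * C) A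
  B := Matrix.fromRows (-flat C) (-(flat C * K))
  C := Matrix.fromCols (-(K * C)) C
  D := K

section Cascade

variable {α μ : Type} [Fintype α] [DecidableEq α] [Fintype μ] [DecidableEq μ]
    {A : Matrix (α ⊕ α) (α ⊕ α) ℂ} {C : Matrix (μ ⊕ μ) (α ⊕ α) ℂ}
    {K : Matrix (μ ⊕ μ) (μ ⊕ μ) ℂ} {s : ℂ}

theorem smul_one_sub_spectralCascade_A :
    s • (1 : Matrix ((α ⊕ α) ⊕ (α ⊕ α)) ((α ⊕ α) ⊕ (α ⊕ α)) ℂ) - (spectralCascade A C K).A =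
      Matrix.fromBlocks (s • 1 - -flat A) 0 (-(flat C * K * C)) (s • 1 - A) := by
  rw [← Matrix.fromBlocks_one, Matrix.fromBlocks_smul]
  rw [spectralCascade, sub_eq_add_neg, Matrix.fromBlocks_neg, Matrix.fromBlocks_add]
  simp [sub_eq_add_neg]

theorem mem_resolventSet_spectralCascade_A :
    s ∈ resolventSet ℂ (spectralCascade A C K).A ↔
      -star s ∈ resolventSet ℂ A ∧ s ∈ resolventSet ℂ A := by
  rw [mem_resolventSet_iff_isUnit, smul_one_sub_spectralCascade_A, Matrix.isUnit_fromBlocks_zero₁₂,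
    ← mem_resolventSet_iff_isUnit, mem_resolventSet_neg_flat_iff, ← mem_resolventSet_iff_isUnit]

theorem flat_one_sub_transfer :
    flat (1 - C * ((-star s) • (1 : Matrix (α ⊕ α) (α ⊕ α) ℂ) - A)⁻¹ * flat C) =
      1 + C * (s • (1 : Matrix (α ⊕ α) (α ⊕ α) ℂ) - -flat A)⁻¹ * flat C := by
  have h : star (-star s) • (1 : Matrix (α ⊕ α) (α ⊕ α) ℂ) - flat A = -(s • 1 - -flat A) := by
    simp; abel
  -- The inverse of a singular matrix is `0` by convention, so this needs no invertibility, and the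
  -- lemma holds for every `s`.
  have h' : ∀ M : Matrix (α ⊕ α) (α ⊕ α) ℂ, (-M)⁻¹ = -M⁻¹ := fun M => by
    by_cases hM : IsUnit M.det
    · exact Matrix.inv_eq_left_inv (by simp [Matrix.nonsing_inv_mul _ hM])
    · rw [Matrix.nonsing_inv_apply_not_isUnit _ hM, Matrix.nonsing_inv_apply_not_isUnit, neg_zero]
      rwa [← Matrix.isUnit_iff_isUnit_det, IsUnit.neg_iff, Matrix.isUnit_iff_isUnit_det]
  rw [flat_sub, flat_one, flat_mul, flat_mul, flat_flat, flat_inv, flat_smul_one_sub, h, h']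
  simp [Matrix.mul_assoc]

theorem spectralCascade_transferFunction (h : s ∈ resolventSet ℂ (spectralCascade A C K).A) :
    (spectralCascade A C K).transferFunction s =
      (1 - C * (s • (1 : Matrix (α ⊕ α) (α ⊕ α) ℂ) - A)⁻¹ * flat C) * K *
      flat (1 - C * ((-star s) • (1 : Matrix (α ⊕ α) (α ⊕ α) ℂ) - A)⁻¹ * flat C) := by
  rw [mem_resolventSet_spectralCascade_A, ← mem_resolventSet_neg_flat_iff,
    mem_resolventSet_iff_isUnit, mem_resolventSet_iff_isUnit] at h
  rw [ClassicalSystem.transferFunction, smul_one_sub_spectralCascade_A,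
    Matrix.inv_fromBlocks_zero₁₂_of_isUnit_iff _ _ _ ⟨fun _ => h.2, fun _ => h.1⟩,
    flat_one_sub_transfer]
  simp only [spectralCascade, Matrix.fromCols_mul_fromBlocks, Matrix.fromCols_mul_fromRows]
  simp only [Matrix.mul_add, Matrix.add_mul, Matrix.sub_mul, Matrix.mul_neg,
    Matrix.neg_mul, neg_neg, Matrix.mul_zero, zero_add, Matrix.one_mul, Matrix.mul_one,
    Matrix.mul_assoc]
  abel

end Cascade

/-! ### The cascade realises the power spectrum -/

namespace QLS

variable {n m : ℕ}

theorem cascade_eq_spectralCascade (G : QLS n m) :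
    G.cascade = spectralCascade G.A G.C (vacuumCov (Fin m)) := rfl

/-- Since `Ξ† = J Ξ♭ J`, the trailing `J` turns the adjoint into a flat. The scattering matrix is
absorbed into the middle factor; this generality is needed because competitors in the definition of
global minimality may have `S ≠ 1`. -/
theorem powerSpectrum_mul_sympJ (G : QLS n m) (V : Matrix (Fin m ⊕ Fin m) (Fin m ⊕ Fin m) ℂ)
    {s : ℂ} (h : s ∈ resolventSet ℂ G.A) (h' : -star s ∈ resolventSet ℂ G.A) :
    G.powerSpectrum V s * sympJ (Fin m) =
      (spectralCascade G.A G.C (G.S * V * G.Sᴴ * sympJ (Fin m))).transferFunction s := by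
  rw [spectralCascade_transferFunction (mem_resolventSet_spectralCascade_A.2 ⟨h', h⟩),
    powerSpectrum, transferFunction, transferFunction, Matrix.conjTranspose_mul,
    conjTranspose_eq_flat (1 - _)]
  simp only [Matrix.mul_assoc, sympJ_mul_self, Matrix.mul_one]

theorem cascade_transferFunction (G : QLS n m) (hS : G.S = 1) {s : ℂ}
    (h : s ∈ resolventSet ℂ G.cascade.A) :
    G.cascade.transferFunction s = G.powerSpectrum (vacuumCov (Fin m)) s * sympJ (Fin m) := by
  rw [cascade_eq_spectralCascade] at h ⊢
  obtain ⟨h1, h2⟩ := mem_resolventSet_spectralCascade_A.1 h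
  rw [powerSpectrum_mul_sympJ _ _ h2 h1, hS]
  simp [vacuumCov_mul_sympJ]

end QLS

namespace ClassicalSystem

variable {ι κ μ ν : Type} [Fintype ι] [Fintype κ] [DecidableEq ι] [DecidableEq κ]
  [Fintype μ] [Fintype ν]

/-- Relabelling of the state coordinates. -/
def reindex (e : κ ≃ ι) (Γ : ClassicalSystem ι μ ν) : ClassicalSystem κ μ ν where
  A := Γ.A.submatrix e e
  B := Γ.B.submatrix e id
  C := Γ.C.submatrix id e
  D := Γ.D

theorem smul_one_sub_reindex_A (e : κ ≃ ι) (Γ : ClassicalSystem ι μ ν) (s : ℂ) :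
    s • (1 : Matrix κ κ ℂ) - (Γ.reindex e).A = (s • (1 : Matrix ι ι ℂ) - Γ.A).submatrix e e := by
  simp [reindex, Matrix.submatrix_sub, Matrix.submatrix_smul]

theorem reindex_transferFunction (e : κ ≃ ι) (Γ : ClassicalSystem ι μ ν) (s : ℂ) :
    (Γ.reindex e).transferFunction s = Γ.transferFunction s := by
  rw [transferFunction, smul_one_sub_reindex_A, Matrix.inv_submatrix_equiv]
  simp [reindex, transferFunction, Matrix.submatrix_mul_equiv, Matrix.submatrix_id_id]

theorem mem_resolventSet_reindex_A (e : κ ≃ ι) (Γ : ClassicalSystem ι μ ν) {s : ℂ} :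
    s ∈ resolventSet ℂ (Γ.reindex e).A ↔ s ∈ resolventSet ℂ Γ.A := by
  rw [mem_resolventSet_iff_isUnit, mem_resolventSet_iff_isUnit, smul_one_sub_reindex_A,
    Matrix.isUnit_submatrix_equiv]

end ClassicalSystem

theorem QLS.isGloballyMinimal_of_cascade_isMinimal {n m : ℕ} (G : QLS n m) (hS : G.S = 1)
    (h : G.cascade.IsMinimal) : G.IsGloballyMinimal (vacuumCov (Fin m)) := by
  intro n' hn' G' _ hsame
  set Γ := spectralCascade G'.A G'.C (G'.S * vacuumCov (Fin m) * G'.Sᴴ * sympJ (Fin m)) with hΓ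
  let e : Fin (Fintype.card ((Fin n' ⊕ Fin n') ⊕ (Fin n' ⊕ Fin n'))) ≃ _ :=
    (Fintype.equivFin _).symm
  refine h _ ?_ (Γ.reindex e) fun s hs hs' => ?_
  · simp only [Fintype.card_sum, Fintype.card_fin]; omega
  · rw [ClassicalSystem.mem_resolventSet_reindex_A, mem_resolventSet_spectralCascade_A] at hs'
    rw [ClassicalSystem.reindex_transferFunction, G.cascade_transferFunction hS hs, hΓ,
      ← QLS.powerSpectrum_mul_sympJ _ _ hs'.2 hs'.1]
    rw [QLS.cascade_eq_spectralCascade, mem_resolventSet_spectralCascade_A] at hs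
    rw [hsame s hs.2 hs.1 hs'.2 hs'.1]

/-! ### Invariant subspaces and modes -/

theorem star_dotProduct_self_eq {ι : Type} [Fintype ι] (v : ι → ℂ) :
    star v ⬝ᵥ v = ((∑ i, ‖v i‖ ^ 2 : ℝ) : ℂ) := by
  simp [dotProduct, Complex.conj_mul']

theorem star_dotProduct_self_re_nonneg {ι : Type} [Fintype ι] (v : ι → ℂ) :
    0 ≤ (star v ⬝ᵥ v).re := by
  rw [star_dotProduct_self_eq, Complex.ofReal_re]
  positivity

theorem eq_zero_of_star_dotProduct_self_re {ι : Type} [Fintype ι] {v : ι → ℂ}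
    (h : (star v ⬝ᵥ v).re = 0) : v = 0 := by
  rw [star_dotProduct_self_eq, Complex.ofReal_re,
    Finset.sum_eq_zero_iff_of_nonneg fun i _ => by positivity] at h
  ext i
  simpa using h i (Finset.mem_univ i)

theorem Module.End.exists_eigenvector_mem {V : Type*} [AddCommGroup V] [Module ℂ V]
    [FiniteDimensional ℂ V] (L : Module.End ℂ V) {W : Submodule ℂ V} (hW : ∀ x ∈ W, L x ∈ W)
    (hne : W ≠ ⊥) : ∃ c : ℂ, ∃ v ∈ W, v ≠ 0 ∧ L v = c • v := by
  have : Nontrivial W := Submodule.nontrivial_iff_ne_bot.2 hne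
  obtain ⟨c, hc⟩ := Module.End.exists_eigenvalue (L.restrict hW)
  obtain ⟨v, hv⟩ := hc.exists_hasEigenvector
  refine ⟨c, v, v.2, fun h => hv.2 (Subtype.ext h), ?_⟩
  simpa using congrArg Subtype.val hv.apply_eq_smul

section Modes

variable {ι μ ν : Type} [Fintype ι] [Fintype μ] [Fintype ν] [DecidableEq ι]

/-- No right eigenvector of `A` lies in the kernel of `C`. -/
def HasNoUnobservableMode (A : Matrix ι ι ℂ) (C : Matrix ν ι ℂ) : Prop :=
  ∀ (c : ℂ) (v : ι → ℂ), A *ᵥ v = c • v → C *ᵥ v = 0 → v = 0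

/-- No left eigenvector of `A` annihilates `B`. -/
def HasNoUncontrollableMode (A : Matrix ι ι ℂ) (B : Matrix ι μ ℂ) : Prop :=
  ∀ (c : ℂ) (w : ι → ℂ), w ᵥ* A = c • w → w ᵥ* B = 0 → w = 0

/-- Hautus test: the unobservable subspace `⋂ ker (C A ^ k)` is `A`-invariant, so if nonzero it
contains an eigenvector of `A`, which `C` kills (`k = 0`). -/
theorem HasNoUnobservableMode.eq_zero {A : Matrix ι ι ℂ} {C : Matrix ν ι ℂ}
    (h : HasNoUnobservableMode A C) {v : ι → ℂ} (hv : ∀ k : ℕ, C *ᵥ (A ^ k *ᵥ v) = 0) :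
    v = 0 := by
  let W : Submodule ℂ (ι → ℂ) := ⨅ k : ℕ, LinearMap.ker (C * A ^ k).mulVecLin
  have mem : ∀ x, x ∈ W ↔ ∀ k : ℕ, C *ᵥ (A ^ k *ᵥ x) = 0 := fun x => by
    simp [W, Submodule.mem_iInf]
  by_contra hne
  obtain ⟨c, x, hx, hx0, hxc⟩ := Module.End.exists_eigenvector_mem A.mulVecLin (W := W)
    (fun x hx => (mem _).2 fun k => by
      simpa [pow_succ] using (mem x).1 hx (k + 1))
    (fun hW => hne (by simpa [hW] using (mem v).2 hv))
  exact hx0 (h c x (by simpa using hxc) (by simpa using (mem x).1 hx 0))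

/-- Dual Hautus test: the annihilator of a proper `W` is nonzero and invariant under the transpose,
so it contains a left eigenvector of `A` that annihilates `B`. -/
theorem HasNoUncontrollableMode.eq_top {A : Matrix ι ι ℂ} {B : Matrix ι μ ℂ}
    (h : HasNoUncontrollableMode A B) {W : Submodule ℂ (ι → ℂ)}
    (hA : ∀ x ∈ W, A *ᵥ x ∈ W) (hB : ∀ u, B *ᵥ u ∈ W) : W = ⊤ := by
  by_contra hne
  obtain ⟨c, φ, hφ, hφ0, hφc⟩ := Module.End.exists_eigenvector_mem
    (Module.Dual.transpose (R := ℂ) A.mulVecLin) (W := W.dualAnnihilator)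
    (fun φ hφ => (Submodule.mem_dualAnnihilator _).2 fun x hx =>
      (Submodule.mem_dualAnnihilator _).1 hφ _ (hA x hx))
    (fun hW => hne (by
      rw [← Subspace.dualAnnihilator_dualCoannihilator_eq (W := W), hW]; simp))
  have hw : ∀ x, (fun i => φ (Pi.single i 1)) ⬝ᵥ x = φ x := fun x => by
    conv_rhs => rw [← (Pi.basisFun ℂ ι).sum_repr x]
    simp [dotProduct, mul_comm]
  refine hφ0 ?_
  have h0 := h c (fun i => φ (Pi.single i 1)) ?_ ?_
  · refine LinearMap.ext fun x => ?_
    rw [← hw x, h0, zero_dotProduct, LinearMap.zero_apply]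
  · refine dotProduct_eq _ _ fun x => ?_
    rw [← Matrix.dotProduct_mulVec, hw, smul_dotProduct, hw]
    exact LinearMap.congr_fun hφc x
  · refine dotProduct_eq _ _ fun x => ?_
    rw [← Matrix.dotProduct_mulVec, hw, zero_dotProduct]
    exact (Submodule.mem_dualAnnihilator _).1 hφ _ (hB x)

/-- Conjugating left eigenvectors gives right eigenvectors of the adjoint. The sign is that of the
costate equation `q' = -A† q`. -/
theorem HasNoUncontrollableMode.neg_conjTranspose {A : Matrix ι ι ℂ} {B : Matrix ι μ ℂ}
    (h : HasNoUncontrollableMode A B) : HasNoUnobservableMode (-Aᴴ) Bᴴ := by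
  intro c v hA hB
  have h1 : Aᴴ *ᵥ v = (-c) • v := by
    rw [neg_smul, ← hA, Matrix.neg_mulVec, neg_neg]
  have := h (star (-c)) (star v)
    (by rw [← Matrix.conjTranspose_conjTranspose A, ← Matrix.star_mulVec, h1, star_smul])
    (by rw [← Matrix.conjTranspose_conjTranspose B, ← Matrix.star_mulVec, hB, star_zero])
  simpa using this

end Modes

/-! ### Linear differential equations -/

theorem HasDerivAt.mulVec {ι ν : Type} [Fintype ι] [Fintype ν] (M : Matrix ν ι ℂ)
    {z : ℝ → ι → ℂ} {z' : ι → ℂ} {t : ℝ} (h : HasDerivAt z z' t) :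
    HasDerivAt (fun t => M *ᵥ z t) (M *ᵥ z') t :=
  ((M.mulVecLin.restrictScalars ℝ).toContinuousLinearMap.hasFDerivAt.comp_hasDerivAt t h)

theorem HasDerivAt.dotProduct_left {ι : Type} [Fintype ι] (w : ι → ℂ)
    {z : ℝ → ι → ℂ} {z' : ι → ℂ} {t : ℝ} (h : HasDerivAt z z' t) :
    HasDerivAt (fun t => w ⬝ᵥ z t) (w ⬝ᵥ z') t := by
  simp only [dotProduct]
  exact HasDerivAt.fun_sum fun i _ => (hasDerivAt_pi.1 h i).const_mul (w i)

theorem HasDerivAt.star_dotProduct {ι : Type} [Fintype ι]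
    {p z : ℝ → ι → ℂ} {p' z' : ι → ℂ} {t : ℝ} (hp : HasDerivAt p p' t) (h : HasDerivAt z z' t) :
    HasDerivAt (fun t => star (p t) ⬝ᵥ z t) (star p' ⬝ᵥ z t + star (p t) ⬝ᵥ z') t := by
  simp only [dotProduct, ← Finset.sum_add_distrib]
  exact HasDerivAt.fun_sum fun i _ => ((hasDerivAt_pi.1 hp i).star).mul (hasDerivAt_pi.1 h i)

/-- The flow is `exp (t M)`. Only derivatives of its action on vectors are exported, so the matrix
norm stays local to the proof. -/
theorem Matrix.exists_flow {κ : Type} [Fintype κ] [DecidableEq κ] (M : Matrix κ κ ℂ) :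
    ∃ Φ : ℝ → Matrix κ κ ℂ, Φ 0 = 1 ∧
      ∀ z t, HasDerivAt (fun t => Φ t *ᵥ z) (M *ᵥ (Φ t *ᵥ z)) t := by
  let _ : NormedRing (Matrix κ κ ℂ) := Matrix.linftyOpNormedRing
  let _ : NormedAlgebra ℝ (Matrix κ κ ℂ) := Matrix.linftyOpNormedAlgebra
  refine ⟨fun t => NormedSpace.exp (t • M), by simp, fun z t => ?_⟩
  have h := hasDerivAt_exp_smul_const' (𝕂 := ℝ) M t
  have h2 :=
    ((Matrix.mulVecBilin ℝ ℂ).flip z).toContinuousLinearMap.hasFDerivAt.comp_hasDerivAt t h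
  rw [Matrix.mulVec_mulVec]
  exact h2

section ODE

variable {ι μ ν : Type} [Fintype ι] [Fintype μ] [Fintype ν] [DecidableEq ι]

/-- Differentiating `C z = 0` repeatedly along the equation gives `C A ^ k z = 0` for all `k`. -/
theorem HasNoUnobservableMode.trajectory_eq_zero {A : Matrix ι ι ℂ} {C : Matrix ν ι ℂ}
    (h : HasNoUnobservableMode A C) {a b : ℝ} {z : ℝ → ι → ℂ}
    (hz : ∀ t ∈ Set.Ioo a b, HasDerivAt z (A *ᵥ z t) t)
    (hC : ∀ t ∈ Set.Ioo a b, C *ᵥ z t = 0) : ∀ t ∈ Set.Ioo a b, z t = 0 := by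
  have key : ∀ k : ℕ, ∀ t ∈ Set.Ioo a b, C *ᵥ (A ^ k *ᵥ z t) = 0 := by
    intro k
    induction k with
    | zero => simpa using hC
    | succ k ih =>
      intro t ht
      have h1 : HasDerivAt (fun t => C *ᵥ (A ^ k *ᵥ z t)) (C *ᵥ (A ^ k *ᵥ (A *ᵥ z t))) t :=
        ((hz t ht).mulVec _).mulVec _
      have h2 : (fun t => C *ᵥ (A ^ k *ᵥ z t)) =ᶠ[𝓝 t] fun _ => 0 :=
        Filter.eventuallyEq_of_mem (isOpen_Ioo.mem_nhds ht) ih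
      have h3 := h1.unique ((hasDerivAt_const t (0 : ν → ℂ)).congr_of_eventuallyEq h2)
      simpa [pow_succ] using h3
  exact fun t ht => h.eq_zero fun k => key k t ht

end ODE

/-! ### Controllability and observability in terms of modes -/

namespace ClassicalSystem

variable {ι μ ν : Type} [Fintype ι] [Fintype μ] [Fintype ν] [DecidableEq ι]

/-- The difference of two trajectories with equal input and output solves the homogeneous equation
with zero output just after `t₀`, hence vanishes there, and by continuity also at `t₀`. -/
theorem isObservable_of_hasNoUnobservableMode {Γ : ClassicalSystem ι μ ν}
    (h : HasNoUnobservableMode Γ.A Γ.C) : Γ.IsObservable := by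
  rintro t₀ t₁ ht u x x' - ⟨hx, F, hF, hxF⟩ ⟨hx', F', hF', hxF'⟩ hout
  -- The time `t₀` may itself be exceptional, so it is removed before taking a neighbourhood free of
  -- exceptional times.
  have hnhds : ((F ∪ F') \ {t₀})ᶜ ∈ 𝓝[>] t₀ :=
    mem_nhdsWithin_of_mem_nhds (((hF.union hF').subset Set.sdiff_subset).isClosed.isOpen_compl.mem_nhds
      (by simp))
  obtain ⟨b, hb, hsub⟩ := (mem_nhdsGT_iff_exists_Ioo_subset' ht).1
    (Filter.inter_mem hnhds (Ioo_mem_nhdsGT ht))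
  have hb : t₀ < b := hb
  have hmem : ∀ t ∈ Set.Ioo t₀ b, t ∈ Set.Ioo t₀ t₁ ∧ t ∉ F ∧ t ∉ F' := fun t htb => by
    have := hsub htb
    have hne : t ≠ t₀ := htb.1.ne'
    simp only [Set.mem_inter_iff, Set.mem_compl_iff, Set.mem_sdiff, Set.mem_union,
      Set.mem_singleton_iff] at this
    tauto
  have hzero := h.trajectory_eq_zero (a := t₀) (b := b) (z := fun t => x t - x' t)
    (fun t htb => by
      obtain ⟨h1, h2, h3⟩ := hmem t htb
      have := (hxF t ⟨h1, h2⟩).sub (hxF' t ⟨h1, h3⟩)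
      rw [add_sub_add_right_eq_sub, ← Matrix.mulVec_sub] at this
      exact this)
    (fun t htb => by
      have := hout t (Set.Ioo_subset_Icc_self (hmem t htb).1)
      simp only [output, add_left_inj] at this
      rw [Matrix.mulVec_sub, this, sub_self])
  have hlim : Filter.Tendsto (fun t => x t - x' t) (𝓝[>] t₀) (𝓝 (x t₀ - x' t₀)) :=
    ((hx.sub hx') t₀ (Set.left_mem_Icc.2 ht.le)).tendsto.mono_left
      (by
        rw [← nhdsWithin_Ioo_eq_nhdsGT ht]
        exact nhdsWithin_mono _ Set.Ioo_subset_Icc_self)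
  have hlim0 : Filter.Tendsto (fun t => x t - x' t) (𝓝[>] t₀) (𝓝 0) :=
    tendsto_const_nhds.congr' (by
      filter_upwards [Ioo_mem_nhdsGT hb] with t htb
      exact (hzero t htb).symm)
  exact sub_eq_zero.1 (tendsto_nhds_unique hlim hlim0)

/-- Gramian argument without integrals: the input is `B† q` with costate `q' = -A† q`, and state and
costate form one linear flow. The final state depends affinely on the initial costate `p`, with
linear part `L`; injectivity of `L` gives surjectivity by dimension. -/
theorem isControllable_of_hasNoUncontrollableMode {Γ : ClassicalSystem ι μ ν}
    (h : HasNoUncontrollableMode Γ.A Γ.B) : Γ.IsControllable := by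
  intro x₀ x₁ t₀ t₁ ht
  obtain ⟨Φ, hΦ0, hΦ⟩ :=
    Matrix.exists_flow (Matrix.fromBlocks Γ.A (Γ.B * Γ.Bᴴ) 0 (-Γ.Aᴴ))
  have hder : ∀ (a p : ι → ℂ) (t : ℝ),
      HasDerivAt (fun t => (Φ t *ᵥ Sum.elim a p) ∘ Sum.inl)
        (Γ.A *ᵥ ((Φ t *ᵥ Sum.elim a p) ∘ Sum.inl) +
          Γ.B *ᵥ (Γ.Bᴴ *ᵥ ((Φ t *ᵥ Sum.elim a p) ∘ Sum.inr))) t ∧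
      HasDerivAt (fun t => (Φ t *ᵥ Sum.elim a p) ∘ Sum.inr)
        ((-Γ.Aᴴ) *ᵥ ((Φ t *ᵥ Sum.elim a p) ∘ Sum.inr)) t := by
    intro a p t
    have h1 := hasDerivAt_pi.1 (hΦ (Sum.elim a p) t)
    rw [Matrix.fromBlocks_mulVec] at h1
    constructor
    · refine hasDerivAt_pi.2 fun i => ?_
      simpa using h1 (Sum.inl i)
    · refine hasDerivAt_pi.2 fun i => ?_
      simpa using h1 (Sum.inr i)
  set T := t₁ - t₀ with hT
  have hT0 : 0 < T := sub_pos.2 ht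
  let L : (ι → ℂ) →ₗ[ℂ] (ι → ℂ) := (Φ T).toBlocks₁₂.mulVecLin
  have hL : ∀ a p, (Φ T *ᵥ Sum.elim a p) ∘ Sum.inl = (Φ T).toBlocks₁₁ *ᵥ a + L p := by
    intro a p
    conv_lhs => rw [← Matrix.fromBlocks_toBlocks (Φ T), Matrix.fromBlocks_mulVec]
    simp [L]
  have hinj : Function.Injective L := by
    refine (injective_iff_map_eq_zero L).2 fun p hp => ?_
    set x : ℝ → ι → ℂ := fun t => (Φ t *ᵥ Sum.elim 0 p) ∘ Sum.inl with hx
    set q : ℝ → ι → ℂ := fun t => (Φ t *ᵥ Sum.elim 0 p) ∘ Sum.inr with hq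
    have hx0 : x 0 = 0 := by simp [hx, hΦ0]
    have hq0 : q 0 = p := by simp [hq, hΦ0]
    have hxT : x T = 0 := by simp only [hx]; rw [hL, hp]; simp
    -- Along the joint flow the pairing `q† x` has derivative `|B† q|² ≥ 0`. It vanishes at both
    -- ends of `[0, T]`, because `x` does, so `B† q = 0` in between.
    have hf : ∀ t, HasDerivAt (fun t => star (q t) ⬝ᵥ x t)
        (star (Γ.Bᴴ *ᵥ q t) ⬝ᵥ (Γ.Bᴴ *ᵥ q t)) t := fun t => by
      convert (hder 0 p t).2.star_dotProduct (hder 0 p t).1 using 1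
      simp only [Matrix.neg_mulVec, star_neg, neg_dotProduct, Matrix.star_mulVec,
        Matrix.conjTranspose_conjTranspose, dotProduct_add, ← Matrix.dotProduct_mulVec, hq]
      abel
    have hfre : ∀ t, HasDerivAt (fun t => (star (q t) ⬝ᵥ x t).re)
        (star (Γ.Bᴴ *ᵥ q t) ⬝ᵥ (Γ.Bᴴ *ᵥ q t)).re t := fun t =>
      Complex.reCLM.hasFDerivAt.comp_hasDerivAt t (hf t)
    have hmono : Monotone fun t => (star (q t) ⬝ᵥ x t).re :=
      monotone_of_deriv_nonneg (fun t => (hfre t).differentiableAt) fun t => by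
        rw [(hfre t).deriv]
        exact star_dotProduct_self_re_nonneg _
    have hzero : ∀ t ∈ Set.Ioo 0 T, (star (q t) ⬝ᵥ x t).re = 0 := fun t htT => by
      have h1 := hmono htT.1.le
      have h2 := hmono htT.2.le
      simp only [hx0, hxT, dotProduct_zero, Complex.zero_re] at h1 h2
      exact le_antisymm h2 h1
    have hB : ∀ t ∈ Set.Ioo 0 T, Γ.Bᴴ *ᵥ q t = 0 := fun t htT => by
      have h2 : (fun t => (star (q t) ⬝ᵥ x t).re) =ᶠ[𝓝 t] fun _ => 0 :=
        Filter.eventuallyEq_of_mem (isOpen_Ioo.mem_nhds htT) hzero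
      have h3 := (hfre t).unique ((hasDerivAt_const t (0 : ℝ)).congr_of_eventuallyEq h2)
      exact eq_zero_of_star_dotProduct_self_re h3
    have hqz := h.neg_conjTranspose.trajectory_eq_zero (fun t _ => (hder 0 p t).2) hB
    have hlim := ((hder 0 p 0).2.continuousAt.tendsto).mono_left
      (nhdsWithin_le_nhds (s := Set.Ioi 0))
    have hlim0 : Filter.Tendsto q (𝓝[>] 0) (𝓝 0) :=
      tendsto_const_nhds.congr' (by
        filter_upwards [Ioo_mem_nhdsGT hT0] with t htb
        exact (hqz t htb).symm)
    rw [← hq0]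
    exact tendsto_nhds_unique hlim hlim0
  obtain ⟨p, hp⟩ := LinearMap.injective_iff_surjective.1 hinj (x₁ - (Φ T).toBlocks₁₁ *ᵥ x₀)
  have hsub : ∀ t, HasDerivAt (fun t : ℝ => t - t₀) 1 t := fun t => (hasDerivAt_id t).sub_const t₀
  have hdx := fun t => (hder x₀ p (t - t₀)).1.scomp t (hsub t)
  have hdq := fun t => (hder x₀ p (t - t₀)).2.scomp t (hsub t)
  have hcu : Continuous fun t => Γ.Bᴴ *ᵥ ((Φ (t - t₀) *ᵥ Sum.elim x₀ p) ∘ Sum.inr) :=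
    continuous_iff_continuousAt.2 fun t => ((hdq t).mulVec Γ.Bᴴ).continuousAt
  refine ⟨fun t => Γ.Bᴴ *ᵥ ((Φ (t - t₀) *ᵥ Sum.elim x₀ p) ∘ Sum.inr),
    fun t => (Φ (t - t₀) *ᵥ Sum.elim x₀ p) ∘ Sum.inl, ⟨⟨∅, Set.finite_empty, hcu.continuousOn⟩,
      fun t _ => ⟨_, hcu.continuousAt.tendsto.mono_left nhdsWithin_le_nhds⟩,
      fun t _ => ⟨_, hcu.continuousAt.tendsto.mono_left nhdsWithin_le_nhds⟩⟩,
    ⟨fun t _ => (hdx t).continuousAt.continuousWithinAt, ∅, Set.finite_empty, fun t _ => ?_⟩,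
    ?_, ?_⟩
  · have := hdx t
    rw [one_smul] at this
    exact this
  · simp [hΦ0]
  · simp only [← hT]
    rw [hL, hp]
    simp

/-- A left eigenvector `w` that annihilates `B` makes `exp (-c t) (w ⬝ x)` constant along every
trajectory. Steering from `star w` to `0` then gives `|w|² = 0`. -/
theorem IsControllable.hasNoUncontrollableMode {Γ : ClassicalSystem ι μ ν}
    (h : Γ.IsControllable) : HasNoUncontrollableMode Γ.A Γ.B := by
  intro c w hA hB
  obtain ⟨u, x, -, ⟨hx, F, hF, hxF⟩, hx0, hx1⟩ := h 0 (star w) 0 1 one_pos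
  have hc : ∀ t : ℝ, HasDerivAt (fun t : ℝ => Complex.exp (-c * t)) (Complex.exp (-c * t) * -c) t :=
    fun t => by
      have := ((Complex.ofRealCLM.hasDerivAt (x := t)).const_mul (-c)).cexp
      simpa using this
  have key := MeasureTheory.integral_eq_of_hasDerivAt_off_countable_of_le
    (fun t : ℝ => Complex.exp (-c * t) * (w ⬝ᵥ x t)) (fun _ => 0) zero_le_one hF.countable
    (ContinuousOn.mul (by fun_prop) (by
      simp only [dotProduct]
      exact continuousOn_finsetSum _ fun i _ =>
        continuousOn_const.mul (continuousOn_pi.1 hx i)))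
    (fun t ht => by
      refine ((hc t).mul ((hxF t ht).dotProduct_left w)).congr_deriv ?_
      rw [dotProduct_add, Matrix.dotProduct_mulVec, Matrix.dotProduct_mulVec, hA, hB,
        smul_dotProduct, zero_dotProduct, smul_eq_mul]
      ring)
    intervalIntegrable_const
  rw [intervalIntegral.integral_zero, hx0, hx1, dotProduct_zero, mul_zero, sub_zero] at key
  have hw := (mul_eq_zero.1 key.symm).resolve_left (Complex.exp_ne_zero _)
  rw [dotProduct_comm] at hw
  exact eq_zero_of_star_dotProduct_self_re (by rw [hw, Complex.zero_re])

/-- The trajectories `exp (c t) v` and `0` have the same zero input and zero output. -/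
theorem IsObservable.hasNoUnobservableMode {Γ : ClassicalSystem ι μ ν}
    (h : Γ.IsObservable) : HasNoUnobservableMode Γ.A Γ.C := by
  intro c v hA hC
  have hd : ∀ t : ℝ, HasDerivAt (fun t : ℝ => Complex.exp (c * t) • v)
      ((Complex.exp (c * t) * c) • v) t := fun t => by
    have := (((Complex.ofRealCLM.hasDerivAt (x := t)).const_mul c).cexp).smul_const v
    simpa using this
  have := h 0 1 one_pos (fun _ => 0) (fun t => Complex.exp (c * t) • v) (fun _ => 0)
    ⟨⟨∅, Set.finite_empty, continuousOn_const⟩, fun t _ => ⟨0, tendsto_const_nhds⟩,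
      fun t _ => ⟨0, tendsto_const_nhds⟩⟩
    ⟨fun t _ => (hd t).continuousAt.continuousWithinAt, ∅, Set.finite_empty, fun t _ => by
      simpa [Matrix.mulVec_smul, hA, smul_smul] using hd t⟩
    ⟨continuousOn_const, ∅, Set.finite_empty, fun t _ => by
      simpa using hasDerivAt_const t (0 : ι → ℂ)⟩
    (fun t _ => by simp [output, Matrix.mulVec_smul, hC])
  simpa using this

end ClassicalSystem

/-! ### Markov parameters and minimality -/

theorem Matrix.eventually_isUnit_one_sub_smul {ι : Type} [Fintype ι] [DecidableEq ι]
    (A : Matrix ι ι ℂ) : ∀ᶠ z : ℂ in 𝓝 0, IsUnit (1 - z • A) := by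
  have hc : Continuous fun z : ℂ => (1 - z • A).det := by fun_prop
  have h0 : (1 - (0 : ℂ) • A).det ≠ 0 := by simp
  filter_upwards [hc.continuousAt.eventually_ne h0] with z hz
  rw [Matrix.isUnit_iff_isUnit_det]
  exact isUnit_iff_ne_zero.2 hz

theorem Matrix.tendsto_inv_one_sub_smul {ι : Type} [Fintype ι] [DecidableEq ι]
    (A : Matrix ι ι ℂ) : Filter.Tendsto (fun z : ℂ => (1 - z • A)⁻¹) (𝓝 0) (𝓝 1) := by
  have hc : ContinuousAt (fun z : ℂ => (1 - z • A)⁻¹) 0 := by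
    simp only [Matrix.inv_def, Ring.inverse_eq_inv']
    have h1 : Continuous fun z : ℂ => (1 - z • A).det := by fun_prop
    have h2 : Continuous fun z : ℂ => (1 - z • A).adjugate :=
      Continuous.matrix_adjugate (by fun_prop)
    exact (h1.continuousAt.inv₀ (by simp)).smul h2.continuousAt
  simpa [ContinuousAt] using hc

/-- Expansion at `s = ∞`: with `z = s⁻¹` the hypothesis becomes `z C (1 - z A)⁻¹ B + D = 0` near `z
= 0`. The limit gives `D = 0`, and the coefficients are then peeled off one at a time through `z A
(1 - z A)⁻¹ = (1 - z A)⁻¹ - 1`. -/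
theorem Matrix.mul_pow_mul_eq_zero {ι μ ν : Type} [Fintype ι] [DecidableEq ι] [Fintype μ]
    [Fintype ν] {A : Matrix ι ι ℂ} {B : Matrix ι μ ℂ} {C : Matrix ν ι ℂ} {D : Matrix ν μ ℂ}
    {F : Set ℂ} (hF : F.Finite) (h : ∀ s ∉ F, C * (s • 1 - A)⁻¹ * B + D = 0) (k : ℕ) :
    C * A ^ k * B = 0 := by
  have hunit : ∀ᶠ z : ℂ in 𝓝[≠] 0, IsUnit (1 - z • A) :=
    (Matrix.eventually_isUnit_one_sub_smul A).filter_mono nhdsWithin_le_nhds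
  have hne : ∀ᶠ z : ℂ in 𝓝[≠] 0, z ≠ 0 := eventually_mem_nhdsWithin
  have hlim := (Matrix.tendsto_inv_one_sub_smul A).mono_left (nhdsWithin_le_nhds (s := {0}ᶜ))
  have hlimC : ∀ M : Matrix ν ι ℂ,
      Filter.Tendsto (fun z : ℂ => M * (1 - z • A)⁻¹ * B) (𝓝[≠] 0) (𝓝 (M * B)) := fun M => by
    have hc : Continuous fun X : Matrix ι ι ℂ => M * X * B := by fun_prop
    simpa [Function.comp_def] using (hc.tendsto 1).comp hlim
  have hF' : ∀ᶠ z : ℂ in 𝓝[≠] 0, z⁻¹ ∉ F := by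
    -- If `0 ∈ F`, the convention `0⁻¹ = 0` puts `0` into the image, so it is removed; the limit is
    -- over `z ≠ 0` anyway.
    have hG : ((fun z : ℂ => z⁻¹) '' F \ {0})ᶜ ∈ 𝓝 (0 : ℂ) :=
      ((hF.image _).subset Set.sdiff_subset).isClosed.isOpen_compl.mem_nhds (by simp)
    filter_upwards [mem_nhdsWithin_of_mem_nhds hG, hne] with z hz hz0 hzF
    exact hz ⟨⟨z⁻¹, hzF, inv_inv z⟩, hz0⟩
  have hsum : ∀ᶠ z : ℂ in 𝓝[≠] 0, z • (C * (1 - z • A)⁻¹ * B) + D = 0 := by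
    filter_upwards [hunit, hne, hF'] with z hz hz0 hzF
    have hinv : (z⁻¹ • (1 : Matrix ι ι ℂ) - A)⁻¹ = z • (1 - z • A)⁻¹ := by
      refine Matrix.inv_eq_left_inv ?_
      have h1 : z⁻¹ • (1 : Matrix ι ι ℂ) - A = z⁻¹ • (1 - z • A) := by
        rw [smul_sub, smul_smul, inv_mul_cancel₀ hz0, one_smul]
      rw [h1, Matrix.smul_mul, Matrix.mul_smul, smul_smul, mul_inv_cancel₀ hz0, one_smul,
        Matrix.nonsing_inv_mul _ ((Matrix.isUnit_iff_isUnit_det _).1 hz)]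
    have := h _ hzF
    rw [hinv] at this
    simpa using this
  have hD : D = 0 := by
    have h1 : Filter.Tendsto (fun z : ℂ => z • (C * (1 - z • A)⁻¹ * B) + D) (𝓝[≠] 0)
        (𝓝 ((0 : ℂ) • (C * B) + D)) :=
      ((Filter.tendsto_id.mono_left nhdsWithin_le_nhds).smul (hlimC C)).add_const D
    simpa using tendsto_nhds_unique h1
      ((tendsto_const_nhds (x := (0 : Matrix ν μ ℂ))).congr' (by
        filter_upwards [hsum] with z hz using hz.symm))
  have hvalue : ∀ M : Matrix ν ι ℂ, (∀ᶠ z : ℂ in 𝓝[≠] 0, M * (1 - z • A)⁻¹ * B = 0) →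
      M * B = 0 := fun M hM =>
    tendsto_nhds_unique (hlimC M) ((tendsto_const_nhds (x := (0 : Matrix ν μ ℂ))).congr' (by
        filter_upwards [hM] with z hz using hz.symm))
  refine hvalue _ ?_
  induction k with
  | zero =>
    filter_upwards [hsum, hne] with z hz hz0
    rw [hD, add_zero] at hz
    simpa using (smul_eq_zero.1 hz).resolve_left hz0
  | succ k ih =>
    filter_upwards [hunit, hne, ih] with z hz hz0 hzk
    have h1 : z • (A * (1 - z • A)⁻¹) = (1 - z • A)⁻¹ - 1 := by
      have := Matrix.mul_nonsing_inv _ ((Matrix.isUnit_iff_isUnit_det _).1 hz)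
      rw [Matrix.sub_mul, Matrix.one_mul, Matrix.smul_mul, sub_eq_iff_eq_add] at this
      rw [eq_sub_iff_add_eq, add_comm, ← this]
    refine (smul_eq_zero.1 (?_ : z • (C * A ^ (k + 1) * (1 - z • A)⁻¹ * B) = 0)).resolve_left hz0
    calc z • (C * A ^ (k + 1) * (1 - z • A)⁻¹ * B)
        = C * A ^ k * (z • (A * (1 - z • A)⁻¹)) * B := by
          simp only [pow_succ, Matrix.mul_smul, Matrix.smul_mul, Matrix.mul_assoc]
      _ = 0 := by
          rw [h1, Matrix.mul_sub, Matrix.sub_mul, hzk, Matrix.mul_one, hvalue _ ih, sub_zero]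

namespace ClassicalSystem

variable {ι κ μ ν : Type} [Fintype ι] [Fintype κ] [DecidableEq ι] [DecidableEq κ]
  [Fintype μ] [Fintype ν]

/-- The parallel difference of the two systems has zero transfer function away from the two finite
spectra. -/
theorem SameTransferFunction.markov_eq {Γ : ClassicalSystem ι μ ν} {Γ' : ClassicalSystem κ μ ν}
    (h : Γ.SameTransferFunction Γ') (k : ℕ) :
    Γ.C * Γ.A ^ k * Γ.B = Γ'.C * Γ'.A ^ k * Γ'.B := by
  have hpow : ∀ k : ℕ, (Matrix.fromBlocks Γ.A 0 0 Γ'.A) ^ k =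
      Matrix.fromBlocks (Γ.A ^ k) 0 0 (Γ'.A ^ k) := fun k => by
    induction k with
    | zero => simp
    | succ k ih => simp [pow_succ, ih, Matrix.fromBlocks_multiply]
  have key := Matrix.mul_pow_mul_eq_zero (A := Matrix.fromBlocks Γ.A 0 0 Γ'.A)
    (B := Matrix.fromRows Γ.B Γ'.B) (C := Matrix.fromCols Γ.C (-Γ'.C)) (D := Γ.D - Γ'.D)
    ((Matrix.finite_spectrum Γ.A).union (Matrix.finite_spectrum Γ'.A)) (fun s hs => by
      have h1 : s ∈ resolventSet ℂ Γ.A := by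
        by_contra hc; exact hs (Or.inl hc)
      have h2 : s ∈ resolventSet ℂ Γ'.A := by
        by_contra hc; exact hs (Or.inr hc)
      have hT := h s h1 h2
      rw [mem_resolventSet_iff_isUnit] at h1 h2
      have hb : s • (1 : Matrix (ι ⊕ κ) (ι ⊕ κ) ℂ) - Matrix.fromBlocks Γ.A 0 0 Γ'.A =
          Matrix.fromBlocks (s • 1 - Γ.A) 0 0 (s • 1 - Γ'.A) := by
        rw [← Matrix.fromBlocks_one, Matrix.fromBlocks_smul, sub_eq_add_neg,
          Matrix.fromBlocks_neg, Matrix.fromBlocks_add]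
        simp [sub_eq_add_neg]
      rw [hb, Matrix.inv_fromBlocks_zero₁₂_of_isUnit_iff _ _ _ ⟨fun _ => h2, fun _ => h1⟩,
        Matrix.fromCols_mul_fromBlocks, Matrix.fromCols_mul_fromRows]
      rw [transferFunction, transferFunction, ← sub_eq_zero] at hT
      rw [← hT]
      simp only [Matrix.mul_zero, Matrix.zero_mul, neg_zero, add_zero, zero_add, Matrix.neg_mul]
      abel) k
  rw [hpow, Matrix.fromCols_mul_fromBlocks, Matrix.fromCols_mul_fromRows] at key
  simpa [← sub_eq_add_neg, sub_eq_zero] using key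

/-- `R` is spanned by the pairs of states that the two systems reach with the same inputs. It
projects onto the first state space by controllability, and injectively into the second by
observability and equality of the Markov parameters. -/
theorem card_le_of_sameTransferFunction {Γ : ClassicalSystem ι μ ν}
    {Γ' : ClassicalSystem κ μ ν} (hc : HasNoUncontrollableMode Γ.A Γ.B)
    (ho : HasNoUnobservableMode Γ.A Γ.C) (h : Γ.SameTransferFunction Γ') :
    Fintype.card ι ≤ Fintype.card κ := by
  let R : Submodule ℂ ((ι → ℂ) × (κ → ℂ)) := Submodule.span ℂ (Set.range fun p : ℕ × (μ → ℂ) =>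
    (Γ.A ^ p.1 *ᵥ (Γ.B *ᵥ p.2), Γ'.A ^ p.1 *ᵥ (Γ'.B *ᵥ p.2)))
  have hR : ∀ x ∈ R, ∀ k : ℕ, Γ.C *ᵥ (Γ.A ^ k *ᵥ x.1) = Γ'.C *ᵥ (Γ'.A ^ k *ᵥ x.2) := by
    intro x hx k
    induction hx using Submodule.span_induction with
    | mem x hx =>
      obtain ⟨⟨j, u⟩, rfl⟩ := hx
      have := congrArg (· *ᵥ u) (h.markov_eq (k + j))
      simpa [pow_add, Matrix.mul_assoc] using this
    | zero => simp
    | add x y _ _ hx hy => simp [Matrix.mulVec_add, hx, hy]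
    | smul a x _ hx => simp [Matrix.mulVec_smul, hx]
  have hsurj : R.map (LinearMap.fst ℂ (ι → ℂ) (κ → ℂ)) = ⊤ := by
    refine hc.eq_top ?_ fun u => ?_
    · rintro _ ⟨x, hx, rfl⟩
      refine ⟨(Γ.A *ᵥ x.1, Γ'.A *ᵥ x.2), ?_, rfl⟩
      induction hx using Submodule.span_induction with
      | mem x hx =>
        obtain ⟨⟨j, u⟩, rfl⟩ := hx
        exact Submodule.subset_span ⟨(j + 1, u), by simp [pow_succ', Matrix.mul_assoc]⟩
      | zero =>
        rw [Prod.fst_zero, Prod.snd_zero, Matrix.mulVec_zero, Matrix.mulVec_zero]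
        exact R.zero_mem
      | add x y _ _ hx hy => simpa [Matrix.mulVec_add] using R.add_mem hx hy
      | smul a x _ hx => simpa [Matrix.mulVec_smul] using R.smul_mem a hx
    · exact ⟨_, Submodule.subset_span ⟨(0, u), rfl⟩, by simp⟩
  have hinj : Function.Injective ((LinearMap.snd ℂ (ι → ℂ) (κ → ℂ)).domRestrict R) := by
    refine (injective_iff_map_eq_zero _).2 fun x hx => ?_
    have hx2 : x.1.2 = 0 := hx
    have hx1 : x.1.1 = 0 := ho.eq_zero fun k => by
      rw [hR x.1 x.2 k, hx2, Matrix.mulVec_zero, Matrix.mulVec_zero]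
    exact Subtype.ext (Prod.ext hx1 hx2)
  have h1 : Module.finrank ℂ R ≤ Fintype.card κ := by
    simpa using LinearMap.finrank_le_finrank_of_injective hinj
  have h2 : Fintype.card ι ≤ Module.finrank ℂ R := by
    have := Submodule.finrank_map_le (LinearMap.fst ℂ (ι → ℂ) (κ → ℂ)) R
    rw [hsurj] at this
    simpa using this
  exact h2.trans h1

theorem isMinimal_of_isControllable_of_isObservable {Γ : ClassicalSystem ι μ ν}
    (hc : Γ.IsControllable) (ho : Γ.IsObservable) : Γ.IsMinimal := fun k hk _ h =>
  hk.not_ge <| (card_le_of_sameTransferFunction hc.hasNoUncontrollableMode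
    ho.hasNoUnobservableMode h).trans_eq (Fintype.card_fin k)

end ClassicalSystem

/-! ### Doubled-up matrices and vectors -/

section DoubledUp

variable {α β γ : Type} [Fintype α] [DecidableEq α] [Fintype β] [DecidableEq β]
  [Fintype γ] [DecidableEq γ]

/-- `Z` has the block form `Δ(X, Y)`. -/
def IsDoubledUp (Z : Matrix (α ⊕ α) (β ⊕ β) ℂ) : Prop :=
  ∀ i j, Z i.swap j.swap = star (Z i j)

theorem isDoubledUp_doubledUp (X Y : Matrix α β ℂ) : IsDoubledUp (doubledUp X Y) := by
  rintro (i | i) (j | j) <;> simp [doubledUp]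

theorem IsDoubledUp.eq_doubledUp {Z : Matrix (α ⊕ α) (β ⊕ β) ℂ} (h : IsDoubledUp Z) :
    doubledUp Z.toBlocks₁₁ Z.toBlocks₁₂ = Z := by
  ext (i | i) (j | j)
  · simp [doubledUp, Matrix.toBlocks₁₁]
  · simp [doubledUp, Matrix.toBlocks₁₂]
  · simpa [doubledUp, Matrix.toBlocks₁₂] using (h (.inl i) (.inr j)).symm
  · simpa [doubledUp, Matrix.toBlocks₁₁] using (h (.inl i) (.inl j)).symm

theorem IsDoubledUp.mul {X : Matrix (α ⊕ α) (β ⊕ β) ℂ} {Y : Matrix (β ⊕ β) (γ ⊕ γ) ℂ}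
    (hX : IsDoubledUp X) (hY : IsDoubledUp Y) : IsDoubledUp (X * Y) := by
  intro i j
  rw [Matrix.mul_apply, Matrix.mul_apply, star_sum, ← (Equiv.sumComm β β).sum_comp]
  refine Finset.sum_congr rfl fun k _ => ?_
  rw [Equiv.sumComm_apply, hX, hY, star_mul']

theorem IsDoubledUp.sub {X Y : Matrix (α ⊕ α) (β ⊕ β) ℂ}
    (hX : IsDoubledUp X) (hY : IsDoubledUp Y) : IsDoubledUp (X - Y) := fun i j => by
  rw [Matrix.sub_apply, Matrix.sub_apply, hX, hY, star_sub]

theorem IsDoubledUp.neg {X : Matrix (α ⊕ α) (β ⊕ β) ℂ} (hX : IsDoubledUp X) :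
    IsDoubledUp (-X) := fun i j => by
  rw [Matrix.neg_apply, Matrix.neg_apply, hX, star_neg]

theorem IsDoubledUp.smul {X : Matrix (α ⊕ α) (β ⊕ β) ℂ} (hX : IsDoubledUp X) {c : ℂ}
    (hc : star c = c) : IsDoubledUp (c • X) := fun i j => by
  rw [Matrix.smul_apply, Matrix.smul_apply, hX, star_smul, hc]

theorem IsDoubledUp.conjTranspose {X : Matrix (α ⊕ α) (β ⊕ β) ℂ} (hX : IsDoubledUp X) :
    IsDoubledUp Xᴴ := fun i j => by
  rw [Matrix.conjTranspose_apply, Matrix.conjTranspose_apply, hX]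

theorem isDoubledUp_I_smul_sympJ : IsDoubledUp (Complex.I • sympJ α) := by
  rintro (i | i) (j | j) <;> by_cases h : i = j <;> simp [sympJ, h]

/-- `J` itself is not of doubled-up form, as exchanging the blocks changes its sign, but `i J` is;
the two factors of `J` absorb `i` and `-i`. -/
theorem IsDoubledUp.flat {X : Matrix (α ⊕ α) (β ⊕ β) ℂ} (hX : IsDoubledUp X) :
    IsDoubledUp (flat X) := by
  have h : _root_.flat X = (Complex.I • sympJ β) * Xᴴ * -(Complex.I • sympJ α) := by
    simp [_root_.flat, smul_smul]
  rw [h]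
  exact (isDoubledUp_I_smul_sympJ.mul hX.conjTranspose).mul isDoubledUp_I_smul_sympJ.neg

/-- The conjugation `(a, b) ↦ (conj b, conj a)`. -/
def conjSwap (u : α ⊕ α → ℂ) : α ⊕ α → ℂ := fun i => star (u i.swap)

theorem conjSwap_conjSwap (u : α ⊕ α → ℂ) : conjSwap (conjSwap u) = u := by
  ext i; simp [conjSwap]

theorem conjSwap_zero : conjSwap (0 : α ⊕ α → ℂ) = 0 := by
  ext i; simp [conjSwap]

theorem conjSwap_smul (c : ℂ) (u : α ⊕ α → ℂ) : conjSwap (c • u) = star c • conjSwap u := by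
  ext i; simp [conjSwap]

theorem IsDoubledUp.mulVec_conjSwap {Z : Matrix (α ⊕ α) (β ⊕ β) ℂ} (h : IsDoubledUp Z)
    (u : β ⊕ β → ℂ) : Z *ᵥ conjSwap u = conjSwap (Z *ᵥ u) := by
  ext i
  simp only [Matrix.mulVec, dotProduct, conjSwap, star_sum, star_mul']
  rw [← (Equiv.sumComm β β).sum_comp]
  refine Finset.sum_congr rfl fun k _ => ?_
  have := h i.swap k
  rw [Sum.swap_swap] at this
  simp [this]

/-- The indefinite Hermitian form `u† J v`. -/
def sympForm (u v : α ⊕ α → ℂ) : ℂ := star u ⬝ᵥ (sympJ α *ᵥ v)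

theorem sympForm_eq (u v : α ⊕ α → ℂ) :
    sympForm u v = ∑ i, star (u (.inl i)) * v (.inl i) - ∑ i, star (u (.inr i)) * v (.inr i) := by
  simp [sympForm, sympJ, Matrix.fromBlocks_mulVec, dotProduct, sub_eq_add_neg, Matrix.neg_mulVec]

theorem star_sympForm (u v : α ⊕ α → ℂ) : star (sympForm u v) = sympForm v u := by
  simp only [sympForm_eq, star_sub, star_sum, star_mul', star_star, mul_comm]

theorem sympForm_conjSwap_conjSwap (u v : α ⊕ α → ℂ) :
    sympForm (conjSwap u) (conjSwap v) = -sympForm v u := by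
  simp only [sympForm_eq, conjSwap, Sum.swap_inl, Sum.swap_inr, star_star, neg_sub, mul_comm]

theorem sympForm_conjSwap_self (u : α ⊕ α → ℂ) : sympForm u (conjSwap u) = 0 := by
  simp only [sympForm_eq, conjSwap, Sum.swap_inl, Sum.swap_inr, sub_eq_zero, mul_comm]

theorem sympForm_self_eq_re (u : α ⊕ α → ℂ) : sympForm u u = ((sympForm u u).re : ℂ) :=
  (Complex.conj_eq_iff_re.1 (star_sympForm u u)).symm

theorem sympForm_smul_smul (c d : ℂ) (u v : α ⊕ α → ℂ) :
    sympForm (c • u) (d • v) = star c * d * sympForm u v := by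
  simp [sympForm, Matrix.mulVec_smul, mul_assoc, mul_left_comm]

theorem exists_sympForm_self_eq_one {u : α ⊕ α → ℂ} (h : 0 < (sympForm u u).re) :
    ∃ c : ℂ, c ≠ 0 ∧ sympForm (c • u) (c • u) = 1 := by
  have h0 : Real.sqrt (sympForm u u).re ≠ 0 := (Real.sqrt_pos.2 h).ne'
  refine ⟨((Real.sqrt (sympForm u u).re)⁻¹ : ℝ), by simpa using h0, ?_⟩
  rw [sympForm_smul_smul, sympForm_self_eq_re u]
  have h1 : (Real.sqrt (sympForm u u).re)⁻¹ * (Real.sqrt (sympForm u u).re)⁻¹ *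
      (sympForm u u).re = 1 := by
    nth_rewrite 3 [← Real.mul_self_sqrt h.le]
    field_simp
  have h2 := congrArg (fun r : ℝ => (r : ℂ)) h1
  simpa using h2

/-- Polarisation with `a + b` and `a + i b`, valid over `ℂ` without assuming `H` Hermitian. -/
theorem Matrix.eq_zero_of_star_dotProduct_mulVec {ι : Type} [Fintype ι] [DecidableEq ι]
    {H : Matrix ι ι ℂ} (h : ∀ x, star x ⬝ᵥ (H *ᵥ x) = 0) : H = 0 := by
  have key : ∀ a b, star a ⬝ᵥ (H *ᵥ b) = 0 := fun a b => by
    have h1 := h (a + b)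
    have h2 := h (a + Complex.I • b)
    simp only [star_add, star_smul, add_dotProduct, smul_dotProduct, Matrix.mulVec_add,
      Matrix.mulVec_smul, dotProduct_add, dotProduct_smul, h, smul_eq_mul, Complex.star_def,
      Complex.conj_I] at h1 h2
    linear_combination (1 / 2 : ℂ) * h1 - (Complex.I / 2) * h2 +
      (1 / 2 * star a ⬝ᵥ (H *ᵥ b) - 1 / 2 * star b ⬝ᵥ (H *ᵥ a)) * Complex.I_mul_I
  refine Matrix.ext_of_mulVec_single fun i => ?_
  rw [Matrix.zero_mulVec]
  exact eq_zero_of_star_dotProduct_self_re (by rw [key, Complex.zero_re])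

/-! ### Symplectic bases -/

/-- `P = 1 - T T♭` is the `J`-orthogonal projection off the columns of `T`. It is nonzero, so by
polarisation its range contains a vector of nonzero `J`-norm. Conjugation preserves the kernel of
`T♭` and flips the sign of the norm, so the norm can be taken positive. -/
theorem exists_sympForm_self_eq_one_of_card_lt {T : Matrix (α ⊕ α) (β ⊕ β) ℂ}
    (hT : IsDoubledUp T) (hTT : flat T * T = 1) (hcard : Fintype.card β < Fintype.card α) :
    ∃ u, sympForm u u = 1 ∧ flat T *ᵥ u = 0 := by
  set P : Matrix (α ⊕ α) (α ⊕ α) ℂ := 1 - T * flat T with hP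
  have hTP : flat T * P = 0 := by
    rw [hP, Matrix.mul_sub, ← Matrix.mul_assoc, hTT, Matrix.mul_one, Matrix.one_mul, sub_self]
  have hPP : flat P * P = P := by
    have : flat P = P := by rw [hP, flat_sub, flat_one, flat_mul, flat_flat]
    rw [this]
    nth_rewrite 1 [hP]
    rw [Matrix.sub_mul, Matrix.mul_assoc, hTP, Matrix.mul_zero, Matrix.one_mul, sub_zero]
  have hP0 : P ≠ 0 := fun h0 => by
    -- The trace of `P` is `2 (card α - card β)`, which is nonzero.
    have htr := congrArg Matrix.trace h0
    rw [hP, Matrix.trace_sub, Matrix.trace_mul_comm, hTT] at htr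
    simp only [Matrix.trace_one, Fintype.card_sum, Matrix.trace_zero, sub_eq_zero] at htr
    have := Nat.cast_injective htr
    omega
  obtain ⟨x, hx⟩ : ∃ x, star x ⬝ᵥ ((sympJ α * P) *ᵥ x) ≠ 0 := by
    by_contra! hall
    apply hP0
    rw [← sympJ_mul_sympJ_mul P, Matrix.eq_zero_of_star_dotProduct_mulVec hall, Matrix.mul_zero]
  set u := P *ᵥ x with hu
  have huu : sympForm u u = star x ⬝ᵥ ((sympJ α * P) *ᵥ x) := by
    rw [sympForm, hu, Matrix.star_mulVec, ← Matrix.dotProduct_mulVec, Matrix.mulVec_mulVec,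
      Matrix.mulVec_mulVec, conjTranspose_eq_flat P]
    simp only [Matrix.mul_assoc, sympJ_mul_sympJ_mul, hPP]
  have hTu : flat T *ᵥ u = 0 := by rw [hu, Matrix.mulVec_mulVec, hTP, Matrix.zero_mulVec]
  have hre : (sympForm u u).re ≠ 0 := fun h0 => by
    rw [← huu, sympForm_self_eq_re, h0] at hx
    exact hx Complex.ofReal_zero
  rcases lt_or_gt_of_ne hre with hneg | hpos
  · obtain ⟨c, -, hc⟩ := exists_sympForm_self_eq_one (u := conjSwap u)
      (by rw [sympForm_conjSwap_conjSwap, Complex.neg_re]; linarith)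
    exact ⟨_, hc, by rw [Matrix.mulVec_smul, hT.flat.mulVec_conjSwap, hTu, conjSwap_zero,
      smul_zero]⟩
  · obtain ⟨c, -, hc⟩ := exists_sympForm_self_eq_one hpos
    exact ⟨_, hc, by rw [Matrix.mulVec_smul, hTu, smul_zero]⟩

/-- The doubled-up matrix with columns `v j` and `conjSwap (v j)`. -/
def doubledCols (v : β → α ⊕ α → ℂ) : Matrix (α ⊕ α) (β ⊕ β) ℂ :=
  Matrix.of fun p => Sum.elim (fun j => v j p) (fun j => conjSwap (v j) p)

theorem isDoubledUp_doubledCols (v : β → α ⊕ α → ℂ) : IsDoubledUp (doubledCols v) := by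
  rintro i (j | j) <;> simp [doubledCols, conjSwap]

theorem sympJ_mul_flat_mul_apply (v : β → α ⊕ α → ℂ) (w : γ → α ⊕ α → ℂ) (p : β ⊕ β)
    (q : γ ⊕ γ) : (sympJ β * (flat (doubledCols v) * doubledCols w)) p q =
      sympForm (fun i => doubledCols v i p) (fun i => doubledCols w i q) := by
  simp only [flat, Matrix.mul_assoc, sympJ_mul_sympJ_mul, sympForm]
  simp only [Matrix.mul_apply, dotProduct, Matrix.mulVec, Matrix.conjTranspose_apply,
    Pi.star_apply]

theorem flat_doubledCols_mul_self_iff {v : β → α ⊕ α → ℂ} :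
    flat (doubledCols v) * doubledCols v = 1 ↔
      (∀ i j, sympForm (v i) (v j) = if i = j then 1 else 0) ∧
      ∀ i j, sympForm (v i) (conjSwap (v j)) = 0 := by
  have h1 : flat (doubledCols v) * doubledCols v = 1 ↔
      sympJ β * (flat (doubledCols v) * doubledCols v) = sympJ β :=
    ⟨fun h => by rw [h, Matrix.mul_one], fun h => by
      rw [← sympJ_mul_sympJ_mul (flat (doubledCols v) * doubledCols v), h, sympJ_mul_self]⟩
  rw [h1, ← Matrix.ext_iff]
  simp only [sympJ_mul_flat_mul_apply]
  constructor
  · intro h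
    exact ⟨fun i j => by simpa [doubledCols, sympJ, Matrix.one_apply] using h (.inl i) (.inl j),
      fun i j => by simpa [doubledCols, sympJ] using h (.inl i) (.inr j)⟩
  · rintro ⟨ha, hb⟩ (i | i) (j | j)
    · simpa [doubledCols, sympJ, Matrix.one_apply] using ha i j
    · simpa [doubledCols, sympJ] using hb i j
    · have := congrArg star (hb j i)
      rw [star_sympForm, star_zero] at this
      simpa [doubledCols, sympJ] using this
    · have : sympForm (conjSwap (v i)) (conjSwap (v j)) = -if i = j then 1 else 0 := by
        rw [sympForm_conjSwap_conjSwap, ha]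
        simp only [eq_comm]
      simpa [doubledCols, sympJ, Matrix.one_apply] using this

theorem flat_doubledCols_mulVec_eq_zero {v : β → α ⊕ α → ℂ} {u : α ⊕ α → ℂ}
    (h : flat (doubledCols v) *ᵥ u = 0) (j : β) :
    sympForm (v j) u = 0 ∧ sympForm (v j) (conjSwap u) = 0 := by
  have key : ∀ u, flat (doubledCols v) *ᵥ u = 0 → sympForm (v j) u = 0 := fun u hu => by
    have h1 : (doubledCols v)ᴴ *ᵥ (sympJ α *ᵥ u) = 0 := by
      rw [conjTranspose_eq_flat, Matrix.mulVec_mulVec, Matrix.mul_assoc, sympJ_mul_self,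
        Matrix.mul_one, ← Matrix.mulVec_mulVec, hu, Matrix.mulVec_zero]
    have h2 := congrFun h1 (.inl j)
    simpa [Matrix.mulVec, doubledCols, dotProduct, sympForm] using h2
  exact ⟨key u h, key _ (by
    rw [(isDoubledUp_doubledCols v).flat.mulVec_conjSwap, h, conjSwap_zero])⟩

/-- Gram–Schmidt for the indefinite form: while there are fewer than `n` vectors, another of norm
one exists in the kernel of `T♭`, hence `J`-orthogonal to the earlier ones and to their conjugates.
-/
theorem exists_symplectic_family {n : ℕ} {v₀ : Fin n ⊕ Fin n → ℂ} (h₀ : sympForm v₀ v₀ = 1)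
    (k : ℕ) (hk : k < n) : ∃ v : Fin (k + 1) → Fin n ⊕ Fin n → ℂ,
      v 0 = v₀ ∧ flat (doubledCols v) * doubledCols v = 1 := by
  induction k with
  | zero =>
    refine ⟨fun _ => v₀, rfl, flat_doubledCols_mul_self_iff.2 ⟨fun i j => ?_, fun i j => ?_⟩⟩
    · have hij : i = j := Subsingleton.elim (α := Fin 1) i j
      rw [h₀, if_pos hij]
    · exact sympForm_conjSwap_self v₀
  | succ k ih =>
    obtain ⟨v, hv0, hv⟩ := ih (by omega)
    obtain ⟨u, huu, hu⟩ := exists_sympForm_self_eq_one_of_card_lt (isDoubledUp_doubledCols v) hv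
      (by simpa using hk)
    obtain ⟨ha, hb⟩ := flat_doubledCols_mul_self_iff.1 hv
    have hc := flat_doubledCols_mulVec_eq_zero hu
    refine ⟨Fin.snoc v u, ?_, flat_doubledCols_mul_self_iff.2 ⟨fun i j => ?_, fun i j => ?_⟩⟩
    · rw [← hv0, ← Fin.castSucc_zero, Fin.snoc_castSucc]
    · induction i using Fin.lastCases with
      | last =>
        induction j using Fin.lastCases with
        | last => simp [huu]
        | cast j =>
          rw [Fin.snoc_last, Fin.snoc_castSucc, ← star_sympForm, (hc j).1,
            if_neg (Fin.castSucc_lt_last j).ne', star_zero]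
      | cast i =>
        induction j using Fin.lastCases with
        | last =>
          rw [Fin.snoc_last, Fin.snoc_castSucc, (hc i).1, if_neg (Fin.castSucc_lt_last i).ne]
        | cast j => simp [ha]
    · induction i using Fin.lastCases with
      | last =>
        induction j using Fin.lastCases with
        | last => simp [sympForm_conjSwap_self]
        | cast j =>
          have := sympForm_conjSwap_conjSwap (v j) (conjSwap u)
          rw [conjSwap_conjSwap, ← star_sympForm, ← star_sympForm (v j), (hc j).2] at this
          rw [Fin.snoc_last, Fin.snoc_castSucc]
          simpa using this
      | cast i =>
        induction j using Fin.lastCases with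
        | last => rw [Fin.snoc_last, Fin.snoc_castSucc, (hc i).2]
        | cast j => simp [hb]

theorem exists_symplectic_splitting {n : ℕ} {v₀ : Fin (n + 1) ⊕ Fin (n + 1) → ℂ}
    (h₀ : sympForm v₀ v₀ = 1) :
    ∃ E : Matrix (Fin (n + 1) ⊕ Fin (n + 1)) (Fin n ⊕ Fin n) ℂ, IsDoubledUp E ∧
      flat E * E = 1 ∧ E * flat E +
        doubledCols (fun _ : Fin 1 => v₀) * flat (doubledCols fun _ : Fin 1 => v₀) = 1 := by
  obtain ⟨v, hv0, hv⟩ := exists_symplectic_family h₀ n (Nat.lt_succ_self n)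
  obtain ⟨ha, hb⟩ := flat_doubledCols_mul_self_iff.1 hv
  refine ⟨doubledCols fun j => v j.succ, isDoubledUp_doubledCols _,
    flat_doubledCols_mul_self_iff.2 ⟨fun i j => by simp [ha], fun i j => hb _ _⟩, ?_⟩
  have hJ : ∀ (γ : Type) [Fintype γ] [DecidableEq γ] (w : γ → Fin (n + 1) ⊕ Fin (n + 1) → ℂ),
      doubledCols w * flat (doubledCols w) =
        doubledCols w * sympJ γ * (doubledCols w)ᴴ * sympJ _ := fun γ _ _ w => by
    simp only [flat, Matrix.mul_assoc]
  have hsum : ∀ (γ : Type) [Fintype γ] [DecidableEq γ] (w : γ → Fin (n + 1) ⊕ Fin (n + 1) → ℂ),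
      doubledCols w * sympJ γ * (doubledCols w)ᴴ = Matrix.of fun p q =>
        ∑ j, (w j p * star (w j q) - conjSwap (w j) p * star (conjSwap (w j) q)) :=
      fun γ _ _ w => by
    have hd : sympJ γ = Matrix.diagonal (Sum.elim (fun _ => 1) fun _ => -1) := by
      rw [sympJ, ← Matrix.diagonal_one, Matrix.diagonal_neg, Matrix.fromBlocks_diagonal]
    ext p q
    rw [hd, Matrix.mul_apply]
    simp [doubledCols, Matrix.mul_diagonal, Fintype.sum_sum_type, sub_eq_add_neg,
      Finset.sum_add_distrib]
  -- The full family is a square matrix, so its left inverse is also a right inverse; this is the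
  -- completeness relation split below into `v₀` and the rest.
  have hvv : doubledCols v * flat (doubledCols v) = 1 := mul_eq_one_comm.1 hv
  rw [← hvv, hJ, hJ, hJ, ← Matrix.add_mul, hsum, hsum, hsum]
  congr 1
  ext p q
  simp only [Matrix.add_apply, Matrix.of_apply, Fin.sum_univ_succ (n := n), hv0]
  simp [add_comm]

end DoubledUp

/-! ### Transfer functions of physically realizable systems -/

section Transfer

variable {α β μ : Type} [Fintype α] [DecidableEq α] [Fintype β] [DecidableEq β]
  [Fintype μ] [DecidableEq μ]

/-- The transfer function `1 - C (s - A)⁻¹ C♭`. -/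
def quantumTransfer (A : Matrix (α ⊕ α) (α ⊕ α) ℂ) (C : Matrix (μ ⊕ μ) (α ⊕ α) ℂ) (s : ℂ) :
    Matrix (μ ⊕ μ) (μ ⊕ μ) ℂ :=
  1 - C * (s • (1 : Matrix (α ⊕ α) (α ⊕ α) ℂ) - A)⁻¹ * flat C

/-- With `X = s - A` and `Y = s + A♭` the hypothesis reads `C♭ C = X - Y`, and the resolvent
identity cancels the quadratic term against the linear ones. -/
theorem quantumTransfer_mul_flat {A : Matrix (α ⊕ α) (α ⊕ α) ℂ} {C : Matrix (μ ⊕ μ) (α ⊕ α) ℂ}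
    (hAC : A + flat A = -(flat C * C)) {s : ℂ} (h : s ∈ resolventSet ℂ A)
    (h' : -star s ∈ resolventSet ℂ A) :
    quantumTransfer A C s * flat (quantumTransfer A C (-star s)) = 1 := by
  rw [quantumTransfer, quantumTransfer, flat_one_sub_transfer]
  rw [← mem_resolventSet_neg_flat_iff, mem_resolventSet_iff_isUnit,
    Matrix.isUnit_iff_isUnit_det] at h'
  rw [mem_resolventSet_iff_isUnit, Matrix.isUnit_iff_isUnit_det] at h
  have hCC : flat C * C = (s • 1 - A) - (s • 1 - -flat A) := by
    rw [← neg_eq_iff_eq_neg.2 hAC]; abel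
  set X := s • 1 - A
  set Y := s • 1 - -flat A
  have hXY : X⁻¹ * (flat C * C) * Y⁻¹ = Y⁻¹ - X⁻¹ := by
    rw [hCC, Matrix.mul_sub, Matrix.sub_mul, Matrix.nonsing_inv_mul _ h, Matrix.one_mul,
      Matrix.mul_assoc, Matrix.mul_nonsing_inv _ h', Matrix.mul_one]
  have hexp : (1 - C * X⁻¹ * flat C) * (1 + C * Y⁻¹ * flat C) =
      1 + C * (Y⁻¹ - X⁻¹ - X⁻¹ * (flat C * C) * Y⁻¹) * flat C := by
    simp only [Matrix.mul_add, Matrix.sub_mul, Matrix.mul_sub, Matrix.one_mul, Matrix.mul_one,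
      Matrix.mul_assoc]
    abel
  rw [hexp, hXY, sub_self, Matrix.mul_zero, Matrix.zero_mul, add_zero]

theorem vacuumCov_mulVec_inl (u : α ⊕ α → ℂ) (i : α) :
    (vacuumCov α *ᵥ u) (.inl i) = u (.inl i) := by
  simp [vacuumCov, Matrix.fromBlocks_mulVec]

theorem vacuumCov_mulVec_inr (u : α ⊕ α → ℂ) (i : α) : (vacuumCov α *ᵥ u) (.inr i) = 0 := by
  simp [vacuumCov, Matrix.fromBlocks_mulVec]

theorem vacuumCov_eq_diagonal :
    vacuumCov α = Matrix.diagonal (Sum.elim (fun _ => 1) fun _ => 0) := by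
  ext (i | i) (j | j) <;> simp [vacuumCov, Matrix.one_apply, Matrix.diagonal_apply]

theorem flat_vacuumCov : flat (vacuumCov α) = vacuumCov α := by
  rw [flat, vacuumCov_conjTranspose, sympJ_mul_vacuumCov, vacuumCov_mul_sympJ]

/-- A passive system preserves the vacuum: its transfer function commutes with `V`, so `V` moves to
the left and the `J`-unitarity of `Ξ` finishes. -/
theorem quantumTransfer_mul_vacuumCov_mul_conjTranspose {A : Matrix (α ⊕ α) (α ⊕ α) ℂ}
    {C : Matrix (μ ⊕ μ) (α ⊕ α) ℂ} (hAC : A + flat A = -(flat C * C))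
    (hA : vacuumCov α * A = A * vacuumCov α) (hC : vacuumCov μ * C = C * vacuumCov α) {s : ℂ}
    (h : s ∈ resolventSet ℂ A) (h' : -star s ∈ resolventSet ℂ A) :
    quantumTransfer A C s * vacuumCov μ * (quantumTransfer A C (-star s))ᴴ = vacuumCov μ := by
  have hC' : vacuumCov α * flat C = flat C * vacuumCov μ := by
    have := congrArg flat hC
    rw [flat_mul, flat_mul, flat_vacuumCov, flat_vacuumCov] at this
    exact this.symm
  have hu : IsUnit (s • (1 : Matrix (α ⊕ α) (α ⊕ α) ℂ) - A).det := by
    rwa [mem_resolventSet_iff_isUnit, Matrix.isUnit_iff_isUnit_det] at h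
  have hR : vacuumCov α * (s • 1 - A)⁻¹ = (s • 1 - A)⁻¹ * vacuumCov α := by
    have hX : vacuumCov α * (s • 1 - A) = (s • 1 - A) * vacuumCov α := by
      rw [Matrix.mul_sub, Matrix.sub_mul, hA, Matrix.mul_smul, Matrix.smul_mul, Matrix.mul_one,
        Matrix.one_mul]
    calc vacuumCov α * (s • 1 - A)⁻¹
        = (s • 1 - A)⁻¹ * ((s • 1 - A) * vacuumCov α) * (s • 1 - A)⁻¹ := by
          rw [← Matrix.mul_assoc, Matrix.nonsing_inv_mul _ hu, Matrix.one_mul]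
      _ = (s • 1 - A)⁻¹ * vacuumCov α := by
          rw [← hX, Matrix.mul_assoc, Matrix.mul_assoc, Matrix.mul_nonsing_inv _ hu,
            Matrix.mul_one]
  have hV : quantumTransfer A C s * vacuumCov μ = vacuumCov μ * quantumTransfer A C s := by
    rw [quantumTransfer, Matrix.sub_mul, Matrix.mul_sub, Matrix.one_mul, Matrix.mul_one,
      Matrix.mul_assoc, ← hC', ← Matrix.mul_assoc, Matrix.mul_assoc C, ← hR, ← Matrix.mul_assoc,
      ← hC]
    simp only [Matrix.mul_assoc]
  rw [conjTranspose_eq_flat, ← Matrix.mul_assoc, ← Matrix.mul_assoc,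
    Matrix.mul_assoc _ (vacuumCov μ), vacuumCov_mul_sympJ, hV, Matrix.mul_assoc (vacuumCov μ),
    quantumTransfer_mul_flat hAC h h', Matrix.mul_one, vacuumCov_mul_sympJ]

theorem Matrix.mem_spectrum_iff_exists_mulVec_eq_smul {ι : Type} [Fintype ι] [DecidableEq ι]
    {A : Matrix ι ι ℂ} {z : ℂ} : z ∈ spectrum ℂ A ↔ ∃ v, v ≠ 0 ∧ A *ᵥ v = z • v := by
  rw [spectrum.mem_iff, Algebra.algebraMap_eq_smul_one, Matrix.isUnit_iff_isUnit_det,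
    isUnit_iff_ne_zero, not_not, ← Matrix.exists_mulVec_eq_zero_iff]
  simp only [Matrix.sub_mulVec, Matrix.smul_mulVec, Matrix.one_mulVec, sub_eq_zero, eq_comm]

theorem Matrix.isUnit_of_mul_eq_one_of_mul_eq {ι κ : Type} [Fintype ι] [DecidableEq ι]
    [Fintype κ] [DecidableEq κ] {X : Matrix ι ι ℂ} {Y : Matrix κ κ ℂ} {P : Matrix κ ι ℂ}
    {Q : Matrix ι κ ℂ} (hPQ : P * Q = 1) (h : P * X = Y * P) (hX : IsUnit X) : IsUnit Y := by
  have hu : IsUnit X.det := (Matrix.isUnit_iff_isUnit_det _).1 hX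
  refine IsUnit.of_mul_eq_one (P * X⁻¹ * Q) ?_
  rw [← Matrix.mul_assoc, ← Matrix.mul_assoc, ← h, Matrix.mul_assoc P, Matrix.mul_nonsing_inv _ hu,
    Matrix.mul_one, hPQ]

theorem flat_mul_eq_zero_of_splitting {E : Matrix (μ ⊕ μ) (α ⊕ α) ℂ}
    {F : Matrix (μ ⊕ μ) (β ⊕ β) ℂ} (hE : flat E * E = 1) (hF : flat F * F = 1)
    (hEF : E * flat E + F * flat F = 1) : flat F * E = 0 := by
  have h := congrArg (fun M => flat F * M * E) hEF
  simp only [Matrix.mul_add, Matrix.add_mul, Matrix.mul_one] at h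
  rw [← Matrix.mul_assoc, Matrix.mul_assoc _ (flat E) E, hE, ← Matrix.mul_assoc, hF] at h
  simpa using h

theorem splitting_intertwine {A : Matrix (μ ⊕ μ) (μ ⊕ μ) ℂ} {E : Matrix (μ ⊕ μ) (α ⊕ α) ℂ}
    {F : Matrix (μ ⊕ μ) (β ⊕ β) ℂ} {D : Matrix (β ⊕ β) (β ⊕ β) ℂ}
    (hE : flat E * E = 1) (hF : flat F * F = 1) (hEF : E * flat E + F * flat F = 1)
    (hD : flat F * A = D * flat F) : A * E = E * (flat E * A * E) := by
  have hFE := flat_mul_eq_zero_of_splitting hE hF hEF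
  calc A * E = (E * flat E + F * flat F) * (A * E) := by rw [hEF, Matrix.one_mul]
    _ = E * (flat E * A * E) + F * (flat F * A * E) := by
        simp only [Matrix.add_mul, Matrix.mul_assoc]
    _ = _ := by rw [hD, Matrix.mul_assoc D, hFE, Matrix.mul_zero, Matrix.mul_zero, add_zero]

/-- In the symplectic basis `(E, F)` the matrix `A` is block upper triangular, and `A + A♭ = -C♭ C`
forces its off-diagonal block to be `-(C E)♭ (C F)`. This is exactly the coupling of a series
product in which the field meets the `F` modes first. -/
theorem quantumTransfer_splitting {γ : Type} [Fintype γ] [DecidableEq γ]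
    {A : Matrix (μ ⊕ μ) (μ ⊕ μ) ℂ} {C : Matrix (γ ⊕ γ) (μ ⊕ μ) ℂ}
    {E : Matrix (μ ⊕ μ) (α ⊕ α) ℂ} {F : Matrix (μ ⊕ μ) (β ⊕ β) ℂ} {D : Matrix (β ⊕ β) (β ⊕ β) ℂ}
    (hAC : A + flat A = -(flat C * C))
    (hE : flat E * E = 1) (hF : flat F * F = 1) (hEF : E * flat E + F * flat F = 1)
    (hD : flat F * A = D * flat F) {s : ℂ}
    (h' : s ∈ resolventSet ℂ (flat E * A * E)) (h'' : s ∈ resolventSet ℂ D) :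
    quantumTransfer A C s =
      quantumTransfer (flat E * A * E) (C * E) s * quantumTransfer D (C * F) s := by
  have hAE := splitting_intertwine hE hF hEF hD
  have hFE := flat_mul_eq_zero_of_splitting hE hF hEF
  have hEF0 : flat E * F = 0 := by
    have := congrArg flat hFE
    rw [flat_mul, flat_flat] at this
    simpa [flat] using this
  rw [mem_resolventSet_iff_isUnit, Matrix.isUnit_iff_isUnit_det] at h' h''
  have hAF : A * F = F * D - E * (flat (C * E) * (C * F)) := by
    have h1 : flat A * F = F * flat D := by
      have := congrArg flat hD
      rwa [flat_mul, flat_mul, flat_flat] at this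
    have h2 : A = -(flat C * C) - flat A := by rw [← hAC]; abel
    have h3 : flat E * A * F = -(flat (C * E) * (C * F)) := by
      rw [h2, Matrix.mul_sub, Matrix.sub_mul, Matrix.mul_assoc _ (flat A), h1, ← Matrix.mul_assoc,
        hEF0, Matrix.zero_mul, sub_zero, flat_mul]
      simp only [Matrix.mul_neg, Matrix.neg_mul, Matrix.mul_assoc]
    calc A * F = (E * flat E + F * flat F) * (A * F) := by rw [hEF, Matrix.one_mul]
      _ = E * (flat E * A * F) + F * (flat F * A * F) := by
          simp only [Matrix.add_mul, Matrix.mul_assoc]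
      _ = _ := by
          rw [h3, hD, Matrix.mul_assoc D, hF, Matrix.mul_one, Matrix.mul_neg]; abel
  set A' := flat E * A * E
  set X := s • (1 : Matrix (μ ⊕ μ) (μ ⊕ μ) ℂ) - A with hX
  set X' := s • (1 : Matrix (α ⊕ α) (α ⊕ α) ℂ) - A' with hX'
  set Y := s • (1 : Matrix (β ⊕ β) (β ⊕ β) ℂ) - D with hY
  have hXE : X * E = E * X' := by
    rw [hX, hX', Matrix.sub_mul, Matrix.mul_sub, hAE, Matrix.smul_mul, Matrix.mul_smul,
      Matrix.one_mul, Matrix.mul_one]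
  have hXF : X * F = F * Y + E * (flat (C * E) * (C * F)) := by
    rw [hX, hY, Matrix.sub_mul, Matrix.mul_sub, hAF, Matrix.smul_mul, Matrix.mul_smul,
      Matrix.one_mul, Matrix.mul_one]
    abel
  have hinv : X⁻¹ = E * X'⁻¹ * flat E +
      (F - E * X'⁻¹ * (flat (C * E) * (C * F))) * Y⁻¹ * flat F := by
    refine Matrix.inv_eq_right_inv ?_
    rw [Matrix.mul_add, ← Matrix.mul_assoc, ← Matrix.mul_assoc, ← Matrix.mul_assoc,
      ← Matrix.mul_assoc, Matrix.mul_sub, hXF, ← Matrix.mul_assoc X, ← Matrix.mul_assoc X, hXE,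
      Matrix.mul_assoc E X', Matrix.mul_nonsing_inv _ h', Matrix.mul_one, add_sub_cancel_right,
      Matrix.mul_assoc F Y, Matrix.mul_nonsing_inv _ h'', Matrix.mul_one, hEF]
  rw [quantumTransfer, hinv, quantumTransfer, quantumTransfer]
  simp only [flat_mul, Matrix.mul_add, Matrix.add_mul, Matrix.sub_mul, Matrix.mul_sub,
    Matrix.one_mul, Matrix.mul_one, Matrix.mul_assoc]
  abel

end Transfer

/-! ### Physical realizability and the `J`-norm of modes -/

namespace QLS

variable {n m : ℕ}

theorem isDoubledUp_C (G : QLS n m) : IsDoubledUp G.C := isDoubledUp_doubledUp _ _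

theorem isDoubledUp_Ω (G : QLS n m) : IsDoubledUp G.Ω := isDoubledUp_doubledUp _ _

theorem Ω_conjTranspose (G : QLS n m) : G.Ωᴴ = G.Ω := by
  have h1 : (G.Ωplus.map star)ᴴ = G.Ωplus := by
    ext i j; simpa using congrFun (congrFun G.Ωplus_symmetric i) j
  have h2 : (G.Ωplus)ᴴ = G.Ωplus.map star := by
    conv_lhs => rw [← G.Ωplus_symmetric]
    ext i j; simp
  have h3 : (G.Ωminus.map star)ᴴ = G.Ωminus.map star := by
    conv_rhs => rw [← G.Ωminus_hermitian]
    ext i j; simp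
  rw [Ω, doubledUp, Matrix.fromBlocks_conjTranspose, h1, h2, h3, G.Ωminus_hermitian]

theorem A_add_flat_A (G : QLS n m) : G.A + flat G.A = -(flat G.C * G.C) := by
  have h1 : flat (sympJ (Fin n) * G.Ω) = sympJ (Fin n) * G.Ω := by
    rw [flat, Matrix.conjTranspose_mul, sympJ_conjTranspose, Ω_conjTranspose]
    simp only [Matrix.mul_assoc, sympJ_mul_self, Matrix.mul_one]
  have h2 : star (1 / 2 : ℂ) = 1 / 2 := by simp
  have h3 : star Complex.I = -Complex.I := by simp
  rw [A, flat_sub, flat_neg, flat_smul, flat_smul, h1, flat_mul, flat_flat, h2, h3]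
  module

theorem isDoubledUp_A (G : QLS n m) : IsDoubledUp G.A := by
  rw [A, ← Matrix.smul_mul Complex.I]
  exact ((G.isDoubledUp_C.flat.mul G.isDoubledUp_C).smul (c := 1 / 2) (by simp)).neg.sub
    (isDoubledUp_I_smul_sympJ.mul G.isDoubledUp_Ω)

theorem re_neg_of_mulVec_eq {G : QLS n m} (hG : G.IsHurwitz) {c : ℂ} {v : Fin n ⊕ Fin n → ℂ}
    (hv : v ≠ 0) (h : G.A *ᵥ v = c • v) : c.re < 0 :=
  hG c (Matrix.mem_spectrum_iff_exists_mulVec_eq_smul.2 ⟨v, hv, h⟩)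

theorem re_neg_of_flat_mulVec_eq {G : QLS n m} (hG : G.IsHurwitz) {c : ℂ}
    {v : Fin n ⊕ Fin n → ℂ} (hv : v ≠ 0) (h : flat G.A *ᵥ v = c • v) : c.re < 0 := by
  have hns : c ∈ spectrum ℂ (flat G.A) :=
    Matrix.mem_spectrum_iff_exists_mulVec_eq_smul.2 ⟨v, hv, h⟩
  have h1 : star c ∈ spectrum ℂ G.A := by
    intro hc
    rw [mem_resolventSet_iff_isUnit, ← isUnit_flat_iff, flat_smul_one_sub, star_star] at hc
    exact hns (mem_resolventSet_iff_isUnit.2 hc)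
  simpa using hG _ h1

/-- A mode of `A♭` that does not reach the first half of the output channels has negative norm. -/
theorem sympForm_self_re_neg {G : QLS n m} (hG : G.IsHurwitz) {c : ℂ}
    {f : Fin n ⊕ Fin n → ℂ} (hf : f ≠ 0) (h : flat G.A *ᵥ f = c • f)
    (hV : vacuumCov (Fin m) *ᵥ (G.C *ᵥ f) = 0) : (sympForm f f).re < 0 := by
  have hc := re_neg_of_flat_mulVec_eq hG hf h
  have hAf : G.A *ᵥ f + c • f = -(flat G.C *ᵥ (G.C *ᵥ f)) := by
    rw [← h, ← Matrix.add_mulVec, A_add_flat_A, Matrix.neg_mulVec, Matrix.mulVec_mulVec]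
  have hform : ∀ x y : Fin n ⊕ Fin n → ℂ, sympForm x (G.A *ᵥ y) = sympForm (flat G.A *ᵥ x) y := by
    intro x y
    rw [sympForm, sympForm, Matrix.star_mulVec, ← Matrix.dotProduct_mulVec,
      conjTranspose_eq_flat (flat G.A), flat_flat]
    simp only [Matrix.mulVec_mulVec, Matrix.mul_assoc, sympJ_mul_self, Matrix.mul_one]
  have hformC : sympForm f (flat G.C *ᵥ (G.C *ᵥ f)) = sympForm (G.C *ᵥ f) (G.C *ᵥ f) := by
    rw [sympForm, sympForm, Matrix.star_mulVec, ← Matrix.dotProduct_mulVec,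
      conjTranspose_eq_flat G.C]
    simp only [Matrix.mulVec_mulVec, Matrix.mul_assoc, sympJ_mul_sympJ_mul]
  have hinl : ∀ i, (G.C *ᵥ f) (.inl i) = 0 := fun i => by
    rw [← vacuumCov_mulVec_inl (G.C *ᵥ f), hV, Pi.zero_apply]
  have hCC : sympForm (G.C *ᵥ f) (G.C *ᵥ f) = -(star (G.C *ᵥ f) ⬝ᵥ (G.C *ᵥ f)) := by
    rw [sympForm_eq]
    simp [dotProduct, hinl]
  -- Lyapunov identity: pair `A + A♭ = -C♭ C` with `f`. The sign is reversed because `C f` lives in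
  -- the second half of the channels, where `J = -1`.
  have key : (c + star c) * sympForm f f = star (G.C *ᵥ f) ⬝ᵥ (G.C *ᵥ f) := by
    have h1 := congrArg (fun z => star f ⬝ᵥ (sympJ (Fin n) *ᵥ z)) hAf
    simp only [Matrix.mulVec_add, dotProduct_add, Matrix.mulVec_neg, dotProduct_neg,
      Matrix.mulVec_smul, dotProduct_smul] at h1
    change sympForm f _ + c • sympForm f f = -sympForm f _ at h1
    rw [hform, h, hformC, hCC, neg_neg] at h1
    rw [← h1]
    simp [sympForm]
    ring
  have hre : (2 * c.re) * (sympForm f f).re = (star (G.C *ᵥ f) ⬝ᵥ (G.C *ᵥ f)).re := by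
    rw [← key, sympForm_self_eq_re]
    have : c + star c = ((2 * c.re : ℝ) : ℂ) := by
      rw [Complex.star_def, Complex.add_conj]
    rw [this, ← Complex.ofReal_mul, Complex.ofReal_re, Complex.ofReal_re]
  -- Since `Re c < 0`, a nonnegative norm forces `C f = 0`. Then `A f = -c f` with `Re (-c) > 0`,
  -- contradicting stability.
  by_contra! hge
  have h0 := star_dotProduct_self_re_nonneg (G.C *ᵥ f)
  have hz : (star (G.C *ᵥ f) ⬝ᵥ (G.C *ᵥ f)).re = 0 := by nlinarith
  rw [eq_zero_of_star_dotProduct_self_re hz, Matrix.mulVec_zero, neg_zero,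
    add_eq_zero_iff_eq_neg, ← neg_smul] at hAf
  have := re_neg_of_mulVec_eq hG hf hAf
  rw [Complex.neg_re] at this
  linarith

theorem isDoubledUp_conjTranspose_mul_Ω_mul {n' : ℕ} (G : QLS n m)
    {E : Matrix (Fin n ⊕ Fin n) (Fin n' ⊕ Fin n') ℂ} (hE : IsDoubledUp E) :
    IsDoubledUp (Eᴴ * G.Ω * E) :=
  (hE.conjTranspose.mul G.isDoubledUp_Ω).mul hE

theorem conjTranspose_mul_Ω_mul_conjTranspose {n' : ℕ} (G : QLS n m)
    (E : Matrix (Fin n ⊕ Fin n) (Fin n' ⊕ Fin n') ℂ) : (Eᴴ * G.Ω * E)ᴴ = Eᴴ * G.Ω * E := by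
  simp only [Matrix.conjTranspose_mul, Ω_conjTranspose, Matrix.conjTranspose_conjTranspose,
    Matrix.mul_assoc]

/-- The restriction of a quantum linear system to the modes spanned by the columns of `E`. -/
def restrict {n' : ℕ} (G : QLS n m) {E : Matrix (Fin n ⊕ Fin n) (Fin n' ⊕ Fin n') ℂ}
    (hE : IsDoubledUp E) : QLS n' m where
  Sminus := 1
  Splus := 0
  Cminus := (G.C * E).toBlocks₁₁
  Cplus := (G.C * E).toBlocks₁₂
  Ωminus := (Eᴴ * G.Ω * E).toBlocks₁₁
  Ωplus := (Eᴴ * G.Ω * E).toBlocks₁₂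
  flat_mul_S := by
    have : doubledUp (1 : Matrix (Fin m) (Fin m) ℂ) 0 = 1 := by simp [doubledUp]
    rw [this, flat_one, Matrix.one_mul]
  S_mul_flat := by
    have : doubledUp (1 : Matrix (Fin m) (Fin m) ℂ) 0 = 1 := by simp [doubledUp]
    rw [this, flat_one, Matrix.one_mul]
  Ωminus_hermitian := by
    ext i j
    exact congrFun (congrFun (G.conjTranspose_mul_Ω_mul_conjTranspose E) (.inl i)) (.inl j)
  Ωplus_symmetric := by
    ext i j
    have ha := G.isDoubledUp_conjTranspose_mul_Ω_mul hE (.inr i) (.inl j)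
    have hb := congrFun (congrFun (G.conjTranspose_mul_Ω_mul_conjTranspose E) (.inr i)) (.inl j)
    rw [Matrix.conjTranspose_apply] at hb
    rw [← hb, star_star] at ha
    exact ha.symm

section Restrict

variable {n' : ℕ} (G : QLS n m) {E : Matrix (Fin n ⊕ Fin n) (Fin n' ⊕ Fin n') ℂ}

theorem restrict_S (hE : IsDoubledUp E) : (G.restrict hE).S = 1 := by
  simp [S, restrict, doubledUp]

theorem restrict_C (hE : IsDoubledUp E) : (G.restrict hE).C = G.C * E :=
  (G.isDoubledUp_C.mul hE).eq_doubledUp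

theorem restrict_Ω (hE : IsDoubledUp E) : (G.restrict hE).Ω = Eᴴ * G.Ω * E :=
  (G.isDoubledUp_conjTranspose_mul_Ω_mul hE).eq_doubledUp

theorem restrict_A (hE : IsDoubledUp E) : (G.restrict hE).A = flat E * G.A * E := by
  have h : sympJ (Fin n') * (Eᴴ * G.Ω * E) = flat E * (sympJ (Fin n) * G.Ω) * E := by
    simp only [flat, Matrix.mul_assoc, sympJ_mul_sympJ_mul]
  rw [A, A, restrict_C G hE, restrict_Ω G hE, h, flat_mul]
  simp only [Matrix.mul_sub, Matrix.sub_mul, Matrix.mul_neg, Matrix.neg_mul, Matrix.mul_smul,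
    Matrix.smul_mul, Matrix.mul_assoc]

end Restrict

/-! ### Deleting modes that preserve the vacuum -/

theorem transferFunction_eq_quantumTransfer {G : QLS n m} (hS : G.S = 1) (s : ℂ) :
    G.transferFunction s = quantumTransfer G.A G.C s := by
  rw [transferFunction, hS, Matrix.mul_one, quantumTransfer]

/-- The factor of the `F` modes stands next to `V` in `Ξ V Ξ†` and leaves it unchanged, so the
restriction to `E` has the same power spectrum. It is stable because the range of `E` is
`A`-invariant. -/
theorem not_isGloballyMinimal_of_splitting {n' : ℕ} {β : Type} [Fintype β] [DecidableEq β]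
    {G : QLS n m} (hS : G.S = 1)
    (hG : G.IsHurwitz) (hn : n' < n) {E : Matrix (Fin n ⊕ Fin n) (Fin n' ⊕ Fin n') ℂ}
    {F : Matrix (Fin n ⊕ Fin n) (β ⊕ β) ℂ} {D : Matrix (β ⊕ β) (β ⊕ β) ℂ}
    (hd : IsDoubledUp E) (hE : flat E * E = 1) (hF : flat F * F = 1)
    (hEF : E * flat E + F * flat F = 1) (hD : flat F * G.A = D * flat F)
    (hDV : vacuumCov β * D = D * vacuumCov β)
    (hCV : vacuumCov (Fin m) * (G.C * F) = G.C * F * vacuumCov β) :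
    ¬ G.IsGloballyMinimal (vacuumCov (Fin m)) := by
  intro hmin
  have hAE := splitting_intertwine hE hF hEF hD
  refine hmin n' hn (G.restrict hd) ?_ ?_
  · intro z hz
    rw [restrict_A G hd, Matrix.mem_spectrum_iff_exists_mulVec_eq_smul] at hz
    obtain ⟨v, hv, hv1⟩ := hz
    refine re_neg_of_mulVec_eq hG (v := E *ᵥ v) (fun h0 => hv ?_) ?_
    · rw [← Matrix.one_mulVec v, ← hE, ← Matrix.mulVec_mulVec, h0, Matrix.mulVec_zero]
    · rw [Matrix.mulVec_mulVec, hAE, ← Matrix.mulVec_mulVec, hv1, Matrix.mulVec_smul]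
  · intro s h1 h2 h3 h4
    rw [restrict_A G hd] at h3 h4
    have hres : ∀ s, s ∈ resolventSet ℂ G.A → s ∈ resolventSet ℂ D := fun s hs => by
      rw [mem_resolventSet_iff_isUnit] at hs ⊢
      refine Matrix.isUnit_of_mul_eq_one_of_mul_eq hF ?_ hs
      rw [Matrix.mul_sub, Matrix.sub_mul, hD, Matrix.smul_mul, Matrix.mul_smul, Matrix.mul_one,
        Matrix.one_mul]
    have hDF : D = flat F * G.A * F := by rw [hD, Matrix.mul_assoc, hF, Matrix.mul_one]
    have hDC : D + flat D = -(flat (G.C * F) * (G.C * F)) := by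
      have : D + flat D = flat F * (G.A + flat G.A) * F := by
        rw [hDF, flat_mul, flat_mul, flat_flat, Matrix.mul_add, Matrix.add_mul]
        simp only [Matrix.mul_assoc]
      rw [this, A_add_flat_A, flat_mul]
      simp only [Matrix.mul_neg, Matrix.neg_mul, Matrix.mul_assoc]
    rw [powerSpectrum, powerSpectrum, transferFunction_eq_quantumTransfer hS,
      transferFunction_eq_quantumTransfer hS,
      transferFunction_eq_quantumTransfer (restrict_S G hd),
      transferFunction_eq_quantumTransfer (restrict_S G hd), restrict_A G hd, restrict_C G hd,
      quantumTransfer_splitting G.A_add_flat_A hE hF hEF hD h3 (hres _ h1),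
      quantumTransfer_splitting G.A_add_flat_A hE hF hEF hD h4 (hres _ h2),
      Matrix.conjTranspose_mul, ← Matrix.mul_assoc, Matrix.mul_assoc (quantumTransfer _ _ _),
      Matrix.mul_assoc (quantumTransfer _ _ _),
      quantumTransfer_mul_vacuumCov_mul_conjTranspose hDC hDV hCV (hres _ h1) (hres _ h2)]

/-- The mode to delete is spanned by `v`, a multiple of the conjugate of `f` with norm one, and its
own conjugate. Both are eigenvectors of `A♭`, so the mode has a diagonal system matrix, and `V C f =
0` kills the off-diagonal blocks of its coupling. -/
theorem not_isGloballyMinimal_of_mode {G : QLS n m} (hS : G.S = 1) (hG : G.IsHurwitz) {c : ℂ}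
    {f : Fin n ⊕ Fin n → ℂ} (hf : f ≠ 0) (h : flat G.A *ᵥ f = c • f)
    (hV : vacuumCov (Fin m) *ᵥ (G.C *ᵥ f) = 0) : ¬ G.IsGloballyMinimal (vacuumCov (Fin m)) := by
  obtain ⟨d, -, hd1⟩ := exists_sympForm_self_eq_one (u := conjSwap f) (by
    rw [sympForm_conjSwap_conjSwap, Complex.neg_re, neg_pos]
    exact sympForm_self_re_neg hG hf h hV)
  set v := d • conjSwap f with hv
  have hn : n ≠ 0 := by
    rintro rfl
    exact hf (Subsingleton.elim _ _)
  obtain ⟨n', rfl⟩ := Nat.exists_eq_succ_of_ne_zero hn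
  obtain ⟨E, hd, hE, hEF⟩ := exists_symplectic_splitting hd1
  have hF : flat (doubledCols fun _ : Fin 1 => v) * (doubledCols fun _ : Fin 1 => v) = 1 :=
    flat_doubledCols_mul_self_iff.2 ⟨fun i j => by rw [hd1, if_pos (Subsingleton.elim i j)],
      fun _ _ => sympForm_conjSwap_self v⟩
  have hcv : conjSwap v = star d • f := by rw [hv, conjSwap_smul, conjSwap_conjSwap]
  have hcol1 : flat G.A *ᵥ v = star c • v := by
    rw [hv, Matrix.mulVec_smul, G.isDoubledUp_A.flat.mulVec_conjSwap, h, conjSwap_smul,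
      smul_comm]
  have hcol2 : flat G.A *ᵥ conjSwap v = c • conjSwap v := by
    rw [hcv, Matrix.mulVec_smul, h, smul_comm]
  have hCcol2 : ∀ i, (G.C *ᵥ conjSwap v) (.inl i) = 0 := fun i => by
    rw [hcv, Matrix.mulVec_smul]
    have : (G.C *ᵥ f) (.inl i) = 0 := by
      rw [← vacuumCov_mulVec_inl (G.C *ᵥ f), hV, Pi.zero_apply]
    simp [this]
  have hCcol1 : ∀ i, (G.C *ᵥ v) (.inr i) = 0 := fun i => by
    have := hCcol2 i
    rw [G.isDoubledUp_C.mulVec_conjSwap] at this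
    simpa [conjSwap] using this
  let D : Matrix (Fin 1 ⊕ Fin 1) (Fin 1 ⊕ Fin 1) ℂ :=
    Matrix.diagonal (Sum.elim (fun _ => star c) fun _ => c)
  have hAF : flat G.A * (doubledCols fun _ : Fin 1 => v) =
      (doubledCols fun _ : Fin 1 => v) * D := by
    ext p (j | j)
    · rw [Matrix.mul_diagonal]
      have := congrFun hcol1 p
      simpa [Matrix.mul_apply, Matrix.mulVec, dotProduct, doubledCols, mul_comm] using this
    · rw [Matrix.mul_diagonal]
      have := congrFun hcol2 p
      simpa [Matrix.mul_apply, Matrix.mulVec, dotProduct, doubledCols, mul_comm] using this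
  refine not_isGloballyMinimal_of_splitting hS hG (Nat.lt_succ_self n') (D := flat D) hd hE hF hEF
    ?_ ?_ ?_
  · have := congrArg flat hAF
    rwa [flat_mul, flat_mul, flat_flat] at this
  · have : vacuumCov (Fin 1) * D = D * vacuumCov (Fin 1) := by
      rw [vacuumCov_eq_diagonal, Matrix.diagonal_mul_diagonal, Matrix.diagonal_mul_diagonal]
      simp only [mul_comm]
    have := congrArg flat this
    rw [flat_mul, flat_mul, flat_vacuumCov] at this
    exact this.symm
  · rw [vacuumCov_eq_diagonal, vacuumCov_eq_diagonal]
    ext (i | i) (j | j)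
    · simp
    · have := hCcol2 i
      rw [Matrix.mul_diagonal, Matrix.diagonal_mul]
      simpa [Matrix.mul_apply, Matrix.mulVec, dotProduct, doubledCols] using this
    · have := hCcol1 i
      rw [Matrix.mul_diagonal, Matrix.diagonal_mul]
      simpa [Matrix.mul_apply, Matrix.mulVec, dotProduct, doubledCols] using this.symm
    · simp

/-- Conjugation exchanges the two halves of the channels, so it turns `y` into a mode of the same
kind as `x`. -/
theorem not_isGloballyMinimal_of_two_modes {G : QLS n m} (hS : G.S = 1) (hG : G.IsHurwitz) {c : ℂ}
    {x y : Fin n ⊕ Fin n → ℂ} (hxy : x ≠ 0 ∨ y ≠ 0) (hx : flat G.A *ᵥ x = c • x)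
    (hy : flat G.A *ᵥ y = c • y) (hCx : vacuumCov (Fin m) *ᵥ (G.C *ᵥ x) = 0)
    (hCy : vacuumCov (Fin m) *ᵥ (G.C *ᵥ y) = G.C *ᵥ y) :
    ¬ G.IsGloballyMinimal (vacuumCov (Fin m)) := by
  rcases hxy with hx0 | hy0
  · exact not_isGloballyMinimal_of_mode hS hG hx0 hx hCx
  · refine not_isGloballyMinimal_of_mode hS hG (f := conjSwap y) (c := star c) (fun h0 => hy0 ?_)
      ?_ ?_
    · rw [← conjSwap_conjSwap y, h0, conjSwap_zero]
    · rw [G.isDoubledUp_A.flat.mulVec_conjSwap, hy, conjSwap_smul]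
    · rw [G.isDoubledUp_C.mulVec_conjSwap]
      have h1 : ∀ i, (G.C *ᵥ y) (.inr i) = 0 := fun i => by
        rw [← hCy, vacuumCov_mulVec_inr]
      ext (i | i)
      · rw [vacuumCov_mulVec_inl, conjSwap, Sum.swap_inl, h1, star_zero, Pi.zero_apply]
      · rw [vacuumCov_mulVec_inr, Pi.zero_apply]

theorem hasNoUnobservableMode_cascade {G : QLS n m} (hS : G.S = 1) (hG : G.IsHurwitz)
    (hmin : G.IsGloballyMinimal (vacuumCov (Fin m))) :
    HasNoUnobservableMode G.cascade.A G.cascade.C := by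
  intro c v hA hC
  by_contra hv
  obtain ⟨x, y, rfl⟩ : ∃ x y, v = Sum.elim x y := ⟨_, _, (Sum.elim_comp_inl_inr v).symm⟩
  rw [cascade, Matrix.fromBlocks_mulVec] at hA
  rw [cascade, Matrix.fromCols_mulVec] at hC
  simp only [Sum.elim_comp_inl, Sum.elim_comp_inr, Matrix.zero_mulVec, add_zero] at hA hC
  have hA1 : -flat G.A *ᵥ x = c • x := by
    ext i; exact congrFun hA (.inl i)
  have hA2 : (flat G.C * vacuumCov (Fin m) * G.C) *ᵥ x + G.A *ᵥ y = c • y := by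
    ext i; exact congrFun hA (.inr i)
  have hCxy : G.C *ᵥ y = vacuumCov (Fin m) *ᵥ (G.C *ᵥ x) := by
    rw [Matrix.neg_mulVec, neg_add_eq_zero, ← Matrix.mulVec_mulVec] at hC
    exact hC.symm
  have hx : flat G.A *ᵥ x = (-c) • x := by
    rw [neg_smul, ← hA1, Matrix.neg_mulVec, neg_neg]
  -- Replacing `A` by `-C♭ C - A♭` absorbs the cascade coupling, since `C y = V C x`. So `x` and `y`
  -- are both eigenvectors of `A♭` for `-c`, and `x - y` is invisible in the first half of the
  -- channels while `y` is invisible in the second.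
  have hy : flat G.A *ᵥ y = (-c) • y := by
    have h1 : flat G.A = -(flat G.C * G.C) - G.A := by rw [← A_add_flat_A]; abel
    rw [h1, Matrix.sub_mulVec, Matrix.neg_mulVec, ← Matrix.mulVec_mulVec, hCxy, neg_smul, ← hA2,
      Matrix.mulVec_mulVec, Matrix.mulVec_mulVec]
    abel
  refine not_isGloballyMinimal_of_two_modes hS hG (x := x - y) (y := y) (c := -c) ?_ ?_ hy ?_ ?_
    hmin
  · by_contra! h0
    obtain ⟨h0, rfl⟩ := h0
    rw [sub_zero] at h0
    exact hv (by rw [h0]; ext (i | i) <;> rfl)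
  · rw [Matrix.mulVec_sub, hx, hy, smul_sub]
  · rw [Matrix.mulVec_sub, Matrix.mulVec_sub, hCxy, Matrix.mulVec_mulVec (G.C *ᵥ x) (vacuumCov _),
      vacuumCov_mul_self, sub_self]
  · rw [hCxy, Matrix.mulVec_mulVec, vacuumCov_mul_self]

theorem flat_mulVec_of_vecMul {α β : Type} [Fintype α] [DecidableEq α] [Fintype β]
    [DecidableEq β] (Z : Matrix (α ⊕ α) (β ⊕ β) ℂ) (x : α ⊕ α → ℂ) :
    flat Z *ᵥ (sympJ α *ᵥ star x) = sympJ β *ᵥ star (x ᵥ* Z) := by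
  rw [Matrix.star_vecMul, Matrix.mulVec_mulVec, Matrix.mulVec_mulVec, flat]
  simp only [Matrix.mul_assoc, sympJ_mul_self, Matrix.mul_one]

theorem hasNoUncontrollableMode_cascade {G : QLS n m} (hS : G.S = 1) (hG : G.IsHurwitz)
    (hmin : G.IsGloballyMinimal (vacuumCov (Fin m))) :
    HasNoUncontrollableMode G.cascade.A G.cascade.B := by
  intro c w hA hB
  by_contra hw
  obtain ⟨x, y, rfl⟩ : ∃ x y, w = Sum.elim x y := ⟨_, _, (Sum.elim_comp_inl_inr w).symm⟩
  rw [cascade, Matrix.vecMul_fromBlocks] at hA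
  rw [cascade, Matrix.vecMul_fromRows] at hB
  simp only [Sum.elim_comp_inl, Sum.elim_comp_inr, Matrix.vecMul_zero, zero_add] at hA hB
  have hA1 : x ᵥ* -flat G.A + y ᵥ* (flat G.C * vacuumCov (Fin m) * G.C) = c • x := by
    ext i; exact congrFun hA (.inl i)
  have hy : y ᵥ* G.A = c • y := by
    ext i; exact congrFun hA (.inr i)
  have hxy : x ᵥ* flat G.C = -(y ᵥ* (flat G.C * vacuumCov (Fin m))) := by
    rw [Matrix.vecMul_neg, Matrix.vecMul_neg, neg_add_eq_zero] at hB
    exact hB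
  -- The same cancellation on the left: `x` and `y` are both left eigenvectors of `A` for `c`.
  -- Applying `J` after conjugation makes them right eigenvectors of `A♭`.
  have hx : x ᵥ* G.A = c • x := by
    have h1 : G.A = -flat G.A - flat G.C * G.C := by
      rw [sub_eq_add_neg, ← A_add_flat_A]; abel
    rw [h1, Matrix.vecMul_sub, ← Matrix.vecMul_vecMul, hxy, ← hA1, Matrix.neg_vecMul,
      Matrix.vecMul_vecMul, sub_neg_eq_add]
  have hC : ∀ z : Fin n ⊕ Fin n → ℂ,
      G.C *ᵥ (sympJ (Fin n) *ᵥ star z) = sympJ (Fin m) *ᵥ star (z ᵥ* flat G.C) := fun z => by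
    rw [← flat_mulVec_of_vecMul, flat_flat]
  have hmode : ∀ z : Fin n ⊕ Fin n → ℂ, z ᵥ* G.A = c • z →
      flat G.A *ᵥ (sympJ (Fin n) *ᵥ star z) = star c • (sympJ (Fin n) *ᵥ star z) := fun z hz => by
    rw [flat_mulVec_of_vecMul, hz, star_smul, Matrix.mulVec_smul]
  have hne : ∀ z : Fin n ⊕ Fin n → ℂ, sympJ (Fin n) *ᵥ star z = 0 → z = 0 := fun z hz => by
    have := congrArg (sympJ (Fin n) *ᵥ ·) hz
    simpa [Matrix.mulVec_mulVec, sympJ_mul_self] using this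
  refine not_isGloballyMinimal_of_two_modes hS hG (x := sympJ (Fin n) *ᵥ star (x + y))
    (y := sympJ (Fin n) *ᵥ star x) (c := star c) ?_ (hmode _ ?_) (hmode _ hx) ?_ ?_ hmin
  · by_contra! h0
    have hx0 := hne _ h0.2
    have hy0 := hne _ h0.1
    rw [hx0, zero_add] at hy0
    exact hw (by rw [hx0, hy0]; ext (i | i) <;> rfl)
  · rw [Matrix.add_vecMul, hx, hy, smul_add]
  · rw [hC, Matrix.mulVec_mulVec, vacuumCov_mul_sympJ, ← vacuumCov_conjTranspose (α := Fin m),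
      ← Matrix.star_vecMul, Matrix.add_vecMul, hxy, Matrix.add_vecMul, Matrix.neg_vecMul,
      Matrix.vecMul_vecMul, Matrix.vecMul_vecMul, Matrix.mul_assoc, vacuumCov_mul_self,
      neg_add_cancel, star_zero]
  · rw [hC, hxy, star_neg, ← Matrix.vecMul_vecMul, Matrix.star_vecMul, vacuumCov_conjTranspose]
    simp only [Matrix.mulVec_neg, Matrix.mulVec_mulVec, sympJ_mul_vacuumCov, vacuumCov_mul_self]

end QLS

end

theorem mainTheorem5 {n m : ℕ} (G : QLS n m) (hS : G.S = 1) (hG : G.IsHurwitz) :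
    (∀ s ∈ resolventSet ℂ G.cascade.A,
      G.cascade.transferFunction s = G.powerSpectrum (vacuumCov (Fin m)) s * sympJ (Fin m)) ∧
    (G.IsGloballyMinimal (vacuumCov (Fin m)) ↔ G.cascade.IsMinimal) ∧
    (G.IsGloballyMinimal (vacuumCov (Fin m)) ↔
      G.cascade.IsControllable ∧ G.cascade.IsObservable) := by
  have h13 : G.IsGloballyMinimal (vacuumCov (Fin m)) →
      G.cascade.IsControllable ∧ G.cascade.IsObservable := fun h =>
    ⟨ClassicalSystem.isControllable_of_hasNoUncontrollableMode
        (QLS.hasNoUncontrollableMode_cascade hS hG h),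
      ClassicalSystem.isObservable_of_hasNoUnobservableMode
        (QLS.hasNoUnobservableMode_cascade hS hG h)⟩
  have h32 : G.cascade.IsControllable ∧ G.cascade.IsObservable → G.cascade.IsMinimal := fun h =>
    ClassicalSystem.isMinimal_of_isControllable_of_isObservable h.1 h.2
  have h21 := G.isGloballyMinimal_of_cascade_isMinimal hS
  exact ⟨fun s hs => G.cascade_transferFunction hS hs, ⟨fun h => h32 (h13 h), h21⟩,
    ⟨h13, fun h => h21 (h32 h)⟩⟩
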